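/- **Setting.** Let $\Omega\subset\mathbb R^3$ be bounded and open. Let $\lambda,\sigma>0$, and let $A_e$ (a scalar) and $\boldsymbol B$ (a vector field) be smooth on a neighbourhood of $\overline\Omega$, with $A_e>0$ in $\Omega$, $A_e=0$ on $\partial\Omega$ and $\boldsymbol B\neq 0$ on $\overline\Omega$; write $B=|\boldsymbol B|$. Let $C^\infty(\overline\Omega)$ be the space of functions on $\Omega$ that extend smoothly to a neighbourhood of $\overline\Omega$, and let $\mathfrak X$ be a linear space with $C_c^\infty(\Omega)\subseteq\mathfrak X\subseteq C^\infty(\overline\Omega)$. For $\chi\in\mathfrak X$ put $$\nabla_\perp\chi=-B^{-2}\boldsymbol B\times(\boldsymbol B\times\nabla\chi),\quad \boldsymbol v^\chi=\frac{\boldsymbol B\times\nabla\chi}{B^2},\quad \omega=\nabla\cdot\Big(A_e\frac{\nabla_\perp\chi}{B^2}\Big),\quad \eta=\mathcal D\chi=\lambda A_e\chi-\sigma\omega .$$ The generalized Hasegawa–Mima (GHM) equation is $$\partial_t\,\mathcal D\chi=\nabla\cdot\Big[A_e\Big(\sigma\frac{\boldsymbol B\cdot\nabla\times\boldsymbol v^\chi}{B^2}-1\Big)\boldsymbol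 v^\chi\Big]\quad\text{in }\Omega .$$ The phase space is $\mathcal D(\mathfrak X)$. A functional $F$ on it has functional derivative $F_\eta=\delta F/\delta\eta\in C^\infty(\overline\Omega)$ at $\eta$ if $\frac{d}{ds}F(\eta+s\,\delta\eta)|_{s=0}=\int_\Omega F_\eta\,\delta\eta\,d\boldsymbol x$ for all $\delta\eta\in\mathcal D(\mathfrak X)$. A family $\chi_s$, $s\in\mathbb R^k$, in $C^\infty(\overline\Omega)$ is called smooth if it is jointly smooth in $(s,\boldsymbol x)$ up to $\overline\Omega$. Let $\mathcal A$ be the set of functionals $F$ that have a functional derivative at every $\eta\in\mathcal D(\mathfrak X)$ and for which $F_\eta(\mathcal D\chi_s)$ is a smooth family for every smooth finite-dimensional family $\chi_s$ in $\mathfrak X$. Put, with $\chi=\mathcal D^{-1}\eta$, $$\{F,G\}=\int_\Omega A_e\Big(1-\sigma\frac{\boldsymbol B\cdot\nabla\times\boldsymbol v^\chi}{B^2}\Big)\nabla F_\eta\cdot\frac{\boldsymbol B}{B^2}\times\nabla G_\eta\,d\boldsymbol x,\qquad \{F,G\}'=\int_\Omega\eta\,\nabla F_\eta\cdot\frac{\boldsymbol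 B}{B^2}\times\nabla G_\eta\,d\boldsymbol x,$$ $$H_\Omega=\tfrac12\int_\Omega A_e\Big(\lambda\chi^2+\sigma\frac{|\nabla_\perp\chi|^2}{B^2}\Big)d\boldsymbol x,\quad M_\Omega=c\int_\Omega A_e(1+\lambda\chi)\,d\boldsymbol x,\quad W_\Omega=\int_\Omega A_e\,w\Big(\lambda\chi-\sigma\frac{\omega}{A_e}\Big)d\boldsymbol x,$$ with $c\in\mathbb R$ a constant and $w:\mathbb R\to\mathbb R$ an arbitrary smooth function. A bracket is called antisymmetric on $\mathcal A$ if $\mathcal A$ is closed under linear combinations and products and the bracket is bilinear, alternating, antisymmetric and satisfies the Leibniz rule on $\mathcal A$. It is a Poisson bracket on $\mathcal A$ if moreover it maps $\mathcal A\times\mathcal A$ to $\mathcal A$ and satisfies the Jacobi identity. A Casimir invariant is an element of $\mathcal A$ whose bracket with every element of $\mathcal A$ is zero. **Statement.** (a) $\mathcal D$ is injective on $\mathfrak X$, and functional derivatives are unique. The bracket $\{\cdot,\cdot\}$ is antisymmetric on $\mathcal A$, and $M_\Omega$ is a Casimir invariant of it. Moreover $H_\Omega\in\mathcal A$, with $\delta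 H_\Omega/\delta\eta=\chi$. (b) Suppose $\nabla\times\big(A_e\boldsymbol B/B^2\big)=\boldsymbol 0$ in $\Omega$. Then: 1. $\{\cdot,\cdot\}'$ is an antisymmetric bracket on $\mathcal A$. It is a Poisson bracket on $\mathcal A$ (in particular it satisfies the Jacobi identity) whenever $\mathcal D^{-1}$ is well defined on the functions $\nabla\cdot(\eta\,\frac{\boldsymbol B}{B^2}\times\nabla f)$ in the following sense: for all smooth families $\chi_s$ in $\mathfrak X$ and $f_s$ in $C^\infty(\overline\Omega)$, $s\in\mathbb R^k$, there is a smooth family $\chi'_s$ in $\mathfrak X$ with $\mathcal D\chi'_s=\nabla\cdot(\mathcal D\chi_s\,\frac{\boldsymbol B}{B^2}\times\nabla f_s)$ in $\Omega$. 2. The GHM equation is equivalent to $\partial_t\eta=\{\eta,H_\Omega\}'$: a field $\chi(t)\in\mathfrak X$, jointly smooth in $(t,\boldsymbol x)$ up to $\overline\Omega$ for $t$ in an open set of times, satisfies the GHM equation at time $t$ if and only if $\frac{d}{dt}\int_\Omega\varphi\,\eta\,d\boldsymbol x=\{\int_\Omega\varphi\,\eta\,d\boldsymbol x,H_\Omega\}'$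 at time $t$ for all $\varphi\in C_c^\infty(\Omega)$, and also if and only if $\frac{d}{dt}F(\eta(t))=\{F,H_\Omega\}'(\eta(t))$ at time $t$ for all $F\in\mathcal A$. 3. $W_\Omega$ and $M_\Omega$ are Casimir invariants of $\{\cdot,\cdot\}'$. -/

import Mathlib

open Set MeasureTheory
open scoped ContDiff

noncomputable section

namespace GHM

/-- Euclidean three-space. -/
abbrev E3 := EuclideanSpace ℝ (Fin 3)

/-- Real-valued functionals of a scalar field. -/
abbrev Functional := (E3 → ℝ) → ℝ

/-! ### Vector calculus -/

/-- The partial derivative `∂f/∂xᵢ`. -/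
def pd (i : Fin 3) (f : E3 → ℝ) (x : E3) : ℝ :=
  fderiv ℝ f x (EuclideanSpace.single i 1)

def grad (f : E3 → ℝ) (x : E3) : E3 := !₂[pd 0 f x, pd 1 f x, pd 2 f x]

def divergence (V : E3 → E3) (x : E3) : ℝ := ∑ i : Fin 3, pd i (fun y => V y i) x

def curl (V : E3 → E3) (x : E3) : E3 :=
  !₂[pd 1 (fun y => V y 2) x - pd 2 (fun y => V y 1) x,
     pd 2 (fun y => V y 0) x - pd 0 (fun y => V y 2) x,
     pd 0 (fun y => V y 1) x - pd 1 (fun y => V y 0) x]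

def cross (a b : E3) : E3 :=
  !₂[a 1 * b 2 - a 2 * b 1, a 2 * b 0 - a 0 * b 2, a 0 * b 1 - a 1 * b 0]

/-! ### Functions that are smooth up to the boundary

A function on `Ω` is represented by the function on the whole space that agrees with it on `Ω` and
is zero outside `Ω`, so that two functions on `Ω` are equal iff their representatives are. Since
`Ω` is open, derivatives at points of `Ω` do not see the extension by zero. -/

/-- `f` is smooth on an open neighbourhood of the closure of `Ω`. -/
def SmoothUpTo {V : Type*} [NormedAddCommGroup V] [NormedSpace ℝ V] (Ω : Set E3)
    (f : E3 → V) : Prop :=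
  ∃ U : Set E3, IsOpen U ∧ closure Ω ⊆ U ∧ ContDiffOn ℝ ∞ f U

/-- The space `C^∞(Ω̄)`. -/
def SmoothBar (Ω : Set E3) : Set (E3 → ℝ) :=
  {u | (∀ x, x ∉ Ω → u x = 0) ∧ ∃ f : E3 → ℝ, SmoothUpTo Ω f ∧ EqOn u f Ω}

/-- Families `p s ∈ C^∞(Ω̄)` that depend jointly smoothly on the parameter `s ∈ S` and on the
point of `Ω̄`. -/
def SmoothFamilyOn {P : Type*} [NormedAddCommGroup P] [NormedSpace ℝ P] (Ω : Set E3)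
    (S : Set P) (p : P → E3 → ℝ) : Prop :=
  (∀ s ∈ S, ∀ x, x ∉ Ω → p s x = 0) ∧
  ∃ (U : Set E3) (f : P × E3 → ℝ), IsOpen U ∧ closure Ω ⊆ U ∧
    ContDiffOn ℝ ∞ f (S ×ˢ U) ∧ ∀ s ∈ S, ∀ x ∈ Ω, p s x = f (s, x)

/-- Test functions: smooth with compact support contained in `Ω`. -/
def TestFunctions (Ω : Set E3) : Set (E3 → ℝ) :=
  {φ | ContDiff ℝ ∞ φ ∧ HasCompactSupport φ ∧ tsupport φ ⊆ Ω}

/-! ### The generalized Hasegawa-Mima equation -/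

/-- The data: region, electron density, magnetic field, the constants `λ`, `σ`, and the linear
space `𝔛` to which the field `χ` belongs. -/
structure Setting where
  Ω : Set E3
  A : E3 → ℝ
  B : E3 → E3
  lam : ℝ
  sig : ℝ
  X : Submodule ℝ (E3 → ℝ)

namespace Setting

variable (S : Setting)

/-- `B / B²`. -/
def b (x : E3) : E3 := (‖S.B x‖ ^ 2)⁻¹ • S.B x

/-- `∇_⊥ χ = - B⁻² B × (B × ∇χ)`. -/
def gradPerp (χ : E3 → ℝ) (x : E3) : E3 :=
  -((‖S.B x‖ ^ 2)⁻¹ • cross (S.B x) (cross (S.B x) (grad χ x)))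

/-- `v_E^χ = B × ∇χ / B²`. -/
def vE (χ : E3 → ℝ) (x : E3) : E3 := (‖S.B x‖ ^ 2)⁻¹ • cross (S.B x) (grad χ x)

/-- `ω = ∇ · (A_e ∇_⊥ χ / B²)`. -/
def omega (χ : E3 → ℝ) (x : E3) : ℝ :=
  divergence (fun y => (S.A y / ‖S.B y‖ ^ 2) • S.gradPerp χ y) x

/-- `𝒟χ = λ A_e χ - σ ω`, as a function on `Ω`. -/
def D (χ : E3 → ℝ) : E3 → ℝ :=
  S.Ω.indicator (fun x => S.lam * S.A x * χ x - S.sig * S.omega χ x)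

/-- The phase space of the variable `η = 𝒟χ`, `χ ∈ 𝔛`. -/
def Phase : Set (E3 → ℝ) := S.D '' (S.X : Set (E3 → ℝ))

/-- The inverse operator `𝒟⁻¹`, mapping `η` to `χ ∈ 𝔛`. -/
def Dinv (η : E3 → ℝ) : E3 → ℝ := Function.invFunOn S.D (S.X : Set (E3 → ℝ)) η

/-- `1 - σ B · ∇ × v_E^χ / B²`. -/
def zeta (χ : E3 → ℝ) (x : E3) : ℝ :=
  1 - S.sig * (inner ℝ (S.B x) (curl (S.vE χ) x) / ‖S.B x‖ ^ 2)

/-- The right-hand side `∇ · [A_e (σ B · ∇ × v_E^χ / B² - 1) v_E^χ]` of the equation. -/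
def rhs (χ : E3 → ℝ) (x : E3) : ℝ :=
  divergence (fun y =>
    (S.A y * (S.sig * (inner ℝ (S.B y) (curl (S.vE χ) y) / ‖S.B y‖ ^ 2) - 1)) • S.vE χ y) x

/-- The time-dependent field `χ` satisfies the equation at time `t`, everywhere in `Ω`. -/
def SolvesAt (χ : ℝ → E3 → ℝ) (t : ℝ) : Prop :=
  ∀ x ∈ S.Ω, HasDerivAt (fun s => S.D (χ s) x) (S.rhs (χ t) x) t

/-- The integrability condition `∇ × (A_e B / B²) = 0` in `Ω`. -/
def Integrability : Prop := ∀ x ∈ S.Ω, curl (fun y => S.A y • S.b y) x = 0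

/-! ### Functional derivatives and brackets -/

/-- `g = δF/δη` at `η`: the function `g ∈ C^∞(Ω̄)` represents the first variation of `F` along all
admissible variations `δη = 𝒟δχ`, `δχ ∈ 𝔛`. -/
def HasFunDeriv (F : Functional) (η g : E3 → ℝ) : Prop :=
  g ∈ SmoothBar S.Ω ∧
  ∀ δη ∈ S.Phase, HasDerivAt (fun s : ℝ => F (η + s • δη)) (∫ x in S.Ω, g x * δη x) 0

open Classical in
/-- The functional derivative `δF/δη` at `η`. -/
def funDeriv (F : Functional) (η : E3 → ℝ) : E3 → ℝ :=
  if h : ∃ g, S.HasFunDeriv F η g then h.choose else 0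

/-- Smooth functionals on the phase space: the functional derivative exists everywhere in
`C^∞(Ω̄)` and depends smoothly on the state, in the sense that it takes smooth finite-dimensional
families of states to smooth families. -/
def Observables : Set Functional :=
  {F | ∃ g : (E3 → ℝ) → (E3 → ℝ), (∀ η ∈ S.Phase, S.HasFunDeriv F η (g η)) ∧
    ∀ (k : ℕ) (p : (Fin k → ℝ) → E3 → ℝ), SmoothFamilyOn S.Ω univ p → (∀ s, p s ∈ S.X) →
      SmoothFamilyOn S.Ω univ (fun s => g (S.D (p s)))}

/-- The bracket `{F,G} = ∫ A_e (1 - σ B · ∇ × v_E^χ / B²) ∇F_η · (B/B²) × ∇G_η dx`. -/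
def bracket (F G : Functional) : Functional := fun η =>
  ∫ x in S.Ω, S.A x * S.zeta (S.Dinv η) x *
    inner ℝ (grad (S.funDeriv F η) x) (cross (S.b x) (grad (S.funDeriv G η) x))

/-- The bracket `{F,G}' = ∫ η ∇F_η · (B/B²) × ∇G_η dx`. -/
def bracket' (F G : Functional) : Functional := fun η =>
  ∫ x in S.Ω, η x *
    inner ℝ (grad (S.funDeriv F η) x) (cross (S.b x) (grad (S.funDeriv G η) x))

/-- The operator `𝒟⁻¹` is defined, and smooth in families, on the functions
`∇ · (η (B/B²) × ∇f)`, with `η = 𝒟χ`, `χ ∈ 𝔛` and `f ∈ C^∞(Ω̄)`. -/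
def InverseDefined : Prop :=
  ∀ (k : ℕ) (p q : (Fin k → ℝ) → E3 → ℝ),
    SmoothFamilyOn S.Ω univ p → (∀ s, p s ∈ S.X) → SmoothFamilyOn S.Ω univ q →
    ∃ r : (Fin k → ℝ) → E3 → ℝ, SmoothFamilyOn S.Ω univ r ∧ (∀ s, r s ∈ S.X) ∧
      ∀ s, ∀ x ∈ S.Ω, S.D (r s) x =
        divergence (fun y => S.D (p s) y • cross (S.b y) (grad (q s) y)) x

/-! ### The functionals -/

/-- The energy `H_Ω`, as a functional of `η`. -/
def energy : Functional := fun η =>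
  1 / 2 * ∫ x in S.Ω, S.A x *
    (S.lam * S.Dinv η x ^ 2 + S.sig * (‖S.gradPerp (S.Dinv η) x‖ ^ 2 / ‖S.B x‖ ^ 2))

/-- The mass `M_Ω` with prefactor `c` (`c = m/Z` for the ion mass). -/
def mass (c : ℝ) : Functional := fun η =>
  c * ∫ x in S.Ω, S.A x * (1 + S.lam * S.Dinv η x)

/-- The generalized enstrophy `W_Ω = ∫ A_e w(λχ - σω/A_e) dx`. -/
def enstrophy (w : ℝ → ℝ) : Functional := fun η =>
  ∫ x in S.Ω, S.A x *
    w (S.lam * S.Dinv η x - S.sig * (S.omega (S.Dinv η) x / S.A x))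

/-- The field `η` smeared with `φ`: the functional `η ↦ ∫ φ η dx`, with `δ/δη = φ`. -/
def smeared (φ : E3 → ℝ) : Functional := fun η => ∫ x in S.Ω, φ x * η x

end Setting

/-! ### Bracket axioms, on a class `𝒜` of functionals on a phase space `P` -/

/-- `𝒜` is an algebra of functionals on `P`, and `br` is bilinear, alternating, antisymmetric and
satisfies the Leibniz rule on it. -/
structure IsAntisymmetricBracket (P : Set (E3 → ℝ)) (𝒜 : Set Functional)
    (br : Functional → Functional → Functional) : Prop where
  linear_mem : ∀ F ∈ 𝒜, ∀ G ∈ 𝒜, ∀ a b : ℝ, a • F + b • G ∈ 𝒜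
  mul_mem : ∀ F ∈ 𝒜, ∀ G ∈ 𝒜, F * G ∈ 𝒜
  linear_left : ∀ F ∈ 𝒜, ∀ G ∈ 𝒜, ∀ H ∈ 𝒜, ∀ a b : ℝ, ∀ η ∈ P,
    br (a • F + b • G) H η = a * br F H η + b * br G H η
  linear_right : ∀ F ∈ 𝒜, ∀ G ∈ 𝒜, ∀ H ∈ 𝒜, ∀ a b : ℝ, ∀ η ∈ P,
    br H (a • F + b • G) η = a * br H F η + b * br H G η
  alternating : ∀ F ∈ 𝒜, ∀ η ∈ P, br F F η = 0
  antisymm : ∀ F ∈ 𝒜, ∀ G ∈ 𝒜, ∀ η ∈ P, br F G η = - br G F η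
  leibniz : ∀ F ∈ 𝒜, ∀ G ∈ 𝒜, ∀ H ∈ 𝒜, ∀ η ∈ P,
    br (F * G) H η = F η * br G H η + br F H η * G η

/-- An antisymmetric bracket that maps `𝒜 × 𝒜` to `𝒜` and satisfies the Jacobi identity. -/
structure IsPoissonBracket (P : Set (E3 → ℝ)) (𝒜 : Set Functional)
    (br : Functional → Functional → Functional) : Prop
    extends IsAntisymmetricBracket P 𝒜 br where
  bracket_mem : ∀ F ∈ 𝒜, ∀ G ∈ 𝒜, br F G ∈ 𝒜
  jacobi : ∀ F ∈ 𝒜, ∀ G ∈ 𝒜, ∀ H ∈ 𝒜, ∀ η ∈ P,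
    br F (br G H) η + br G (br H F) η + br H (br F G) η = 0

/-- `C ∈ 𝒜` has vanishing bracket with every element of `𝒜`. -/
def IsCasimir (P : Set (E3 → ℝ)) (𝒜 : Set Functional)
    (br : Functional → Functional → Functional) (C : Functional) : Prop :=
  C ∈ 𝒜 ∧ ∀ G ∈ 𝒜, ∀ η ∈ P, br C G η = 0

end GHM

end

/-!
Extend `A_e` and `B / B²` to smooth functions `a` and `β` on the whole space. Since `a` vanishes on
`∂Ω`, every integration by parts of a field carrying the factor `a` is free of boundary terms. So
`𝒟` is symmetric with `∫ χ 𝒟χ = ∫ a (λ χ² + σ |β × ∇χ|²)`, which gives injectivity and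
`δH/δη = χ`; a difference `u` of two functional derivatives is orthogonal to `𝒟φ` for all test
functions `φ`, hence `𝒟u = 0` and `u = 0`. The mass is an affine function of `∫ η`, so its
functional derivative is constant.

If `∇ × (a β) = 0`, then `η = a q` with `q` smooth up to the boundary, and
`{F, G}' = ∫ a q [F_η, G_η]` for the bracket `[f, g] = ∇f · (β × ∇g)` of functions, where
`a [f, g]` is the divergence of `f a (β × ∇g)`. The enstrophy has functional derivative `w'(q)`, and
`q [w'(q), g] = [q w'(q) - w(q), g]`. As `β · (∇ × β) = 0`, the bracket `[·, ·]` satisfies the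
Jacobi identity pointwise; that of `{·, ·}'` follows because the second variations of the
functionals are symmetric and therefore cancel in pairs in the cyclic sum.
-/

noncomputable section

namespace GHM

open Filter Topology Function

/-! ### Cutoffs and integrals depending on a parameter -/

@[fun_prop]
theorem differentiableAt_of_contDiff_infty {E F : Type*} [NormedAddCommGroup E] [NormedSpace ℝ E]
    [NormedAddCommGroup F] [NormedSpace ℝ F] {f : E → F} (hf : ContDiff ℝ ∞ f) (x : E) :
    DifferentiableAt ℝ f x :=
  hf.differentiable (by simp) x

@[fun_prop]
theorem contDiff_fderiv_apply {E F : Type*} [NormedAddCommGroup E] [NormedSpace ℝ E]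
    [NormedAddCommGroup F] [NormedSpace ℝ F] {f : E → F} (hf : ContDiff ℝ ∞ f) (w : E) :
    ContDiff ℝ ∞ (fun x => fderiv ℝ f x w) :=
  (hf.fderiv_right (by simp)).clm_apply contDiff_const

theorem fderiv_fderiv_apply_comm {E F : Type*} [NormedAddCommGroup E] [NormedSpace ℝ E]
    [NormedAddCommGroup F] [NormedSpace ℝ F] {f : E → F} (hf : ContDiff ℝ ∞ f) (x v w : E) :
    fderiv ℝ (fun y => fderiv ℝ f y w) x v = fderiv ℝ (fun y => fderiv ℝ f y v) x w := by
  have hdiff : DifferentiableAt ℝ (fderiv ℝ f) x :=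
    (hf.fderiv_right (m := ∞) (by simp)).differentiable (by simp) x
  have hsymm : IsSymmSndFDerivAt ℝ f x := hf.contDiffAt.isSymmSndFDerivAt
    (by simpa using WithTop.coe_le_coe.2 (le_top : (2 : ℕ∞) ≤ ⊤))
  rw [fderiv_clm_apply hdiff (differentiableAt_const _),
    fderiv_clm_apply hdiff (differentiableAt_const _)]
  simpa using hsymm v w

theorem exists_contDiff_cutoff {V : Type*} [NormedAddCommGroup V] [NormedSpace ℝ V]
    [FiniteDimensional ℝ V] {K U : Set V} (hK : IsCompact K) (hU : IsOpen U) (hKU : K ⊆ U) :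
    ∃ ρ : V → ℝ, ContDiff ℝ ∞ ρ ∧ HasCompactSupport ρ ∧ tsupport ρ ⊆ U ∧ ∀ x ∈ K, ρ x = 1 := by
  obtain ⟨L, hL, hKL, hLU⟩ := exists_compact_between hK hU hKU
  obtain ⟨ρ, hρ_one, hρ_zero, -⟩ := exists_contMDiffMap_one_nhds_of_subset_interior
    (n := ⊤) (modelWithCornersSelf ℝ V) hK.isClosed hKL
  have hsupp : tsupport ρ ⊆ L :=
    closure_minimal (fun x hx => not_not.1 fun hxL => hx (hρ_zero x hxL)) hL.isClosed
  exact ⟨ρ, ρ.contMDiff.contDiff, hL.of_isClosed_subset (isClosed_tsupport _) hsupp,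
    hsupp.trans hLU, fun x hx => (eventually_nhdsSet_iff_forall.1 hρ_one x hx).self_of_nhds⟩

theorem contDiff_smul_of_tsupport_subset {E F : Type*} [NormedAddCommGroup E] [NormedSpace ℝ E]
    [NormedAddCommGroup F] [NormedSpace ℝ F] {n : WithTop ℕ∞} {ρ : E → ℝ} {f : E → F} {U : Set E}
    (hU : IsOpen U) (hρ : ContDiff ℝ n ρ) (hf : ContDiffOn ℝ n f U) (hρU : tsupport ρ ⊆ U) :
    ContDiff ℝ n (fun x => ρ x • f x) := by
  refine contDiff_iff_contDiffAt.2 fun x => ?_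
  by_cases hx : x ∈ tsupport ρ
  · exact hρ.contDiffAt.smul (hf.contDiffAt (hU.mem_nhds (hρU hx)))
  · have hzero : (fun y => ρ y • f y) =ᶠ[𝓝 x] fun _ => 0 := by
      filter_upwards [(isClosed_tsupport ρ).isOpen_compl.mem_nhds hx] with y hy
      rw [image_eq_zero_of_notMem_tsupport hy, zero_smul]
    exact contDiffAt_const.congr_of_eventuallyEq hzero

section Param

variable {V : Type*} [NormedAddCommGroup V] [NormedSpace ℝ V] [FiniteDimensional ℝ V]
  [MeasurableSpace V] [BorelSpace V] {μ : Measure V} [μ.IsAddHaarMeasure] {W : Set V}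
  {F : Type*} [NormedAddCommGroup F]

theorem integrableOn_of_continuous {h : V → F} (hh : Continuous h)
    (hW : Bornology.IsBounded W) : IntegrableOn h W μ :=
  (hh.continuousOn.integrableOn_compact hW.isCompact_closure).mono_set subset_closure

variable [NormedSpace ℝ F]

/-- With a cutoff `ρ`, the integral is the value at `0` of a convolution of the indicator function
of `W` with `x ↦ ρ (-x) • h s (-x)`. -/
theorem contDiff_setIntegral {P : Type*} [NormedAddCommGroup P] [NormedSpace ℝ P]
    {h : P → V → F} (hh : ContDiff ℝ ∞ (uncurry h)) (hW : MeasurableSet W)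
    (hWb : Bornology.IsBounded W) : ContDiff ℝ ∞ (fun s => ∫ x in W, h s x ∂μ) := by
  obtain ⟨ρ, hρ, hρc, -, hρ_one⟩ := exists_contDiff_cutoff hWb.isCompact_closure isOpen_univ
    (subset_univ _)
  have hconv := contDiffOn_convolution_right_with_param (n := ⊤) (μ := μ)
    (f := W.indicator fun _ => (1 : ℝ)) (ContinuousLinearMap.lsmul ℝ ℝ)
    (g := fun (s : P) x => ρ (-x) • h s (-x)) (s := univ) (k := -tsupport ρ) isOpen_univ
    hρc.isCompact.neg
    (fun s x _ hx => by simp only [image_eq_zero_of_notMem_tsupport hx, zero_smul])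
    ((locallyIntegrable_const (1 : ℝ)).indicator hW)
    (by
      have : ContDiff ℝ ∞ (fun q : P × V => ρ (-q.2) • h q.1 (-q.2)) := by fun_prop
      exact this.contDiffOn)
  rw [univ_prod_univ, contDiffOn_univ] at hconv
  convert hconv.comp (contDiff_id.prodMk (contDiff_const (c := (0 : V)))) using 1
  ext s
  simp only [comp_def, convolution, id, ContinuousLinearMap.lsmul_apply, zero_sub, neg_neg]
  rw [← integral_indicator hW]
  congr 1 with x
  by_cases hx : x ∈ W
  · simp [hx, hρ_one x (subset_closure hx)]
  · simp [hx]

theorem hasDerivAt_setIntegral {h : ℝ → V → F} (hh : ContDiff ℝ 1 (uncurry h))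
    (hW : Bornology.IsBounded W) (t : ℝ) :
    HasDerivAt (fun s => ∫ x in W, h s x ∂μ) (∫ x in W, deriv (fun s => h s x) t ∂μ) t := by
  have hderiv (s : ℝ) (x : V) :
      HasDerivAt (fun r => h r x) (fderiv ℝ (uncurry h) (s, x) (1, 0)) s := by
    have hpair : HasDerivAt (fun r : ℝ => (r, x)) ((1 : ℝ), (0 : V)) s :=
      (hasDerivAt_id s).prodMk (hasDerivAt_const s x)
    exact (hh.differentiable one_ne_zero (s, x)).hasFDerivAt.comp_hasDerivAt s hpair
  have hcont : Continuous (fun q : ℝ × V => fderiv ℝ (uncurry h) q (1, 0)) :=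
    (hh.continuous_fderiv one_ne_zero).clm_apply continuous_const
  have hslice (s : ℝ) : Continuous (h s) := hh.continuous.comp (.prodMk_right s)
  obtain ⟨C, hC⟩ := ((isCompact_closedBall t 1).prod
    hW.isCompact_closure).exists_bound_of_continuousOn hcont.continuousOn
  have hmem : ∀ᵐ x ∂(μ.restrict W), x ∈ closure W :=
    ae_restrict_of_ae_restrict_of_subset subset_closure
      (ae_restrict_mem isClosed_closure.measurableSet)
  have hmain := (hasDerivAt_integral_of_dominated_loc_of_deriv_le (μ := μ.restrict W) (F := h)
    (F' := fun s x => fderiv ℝ (uncurry h) (s, x) (1, 0)) (x₀ := t) (bound := fun _ => C)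
    (Metric.closedBall_mem_nhds t one_pos)
    (Eventually.of_forall fun s => (integrableOn_of_continuous (hslice s) hW).aestronglyMeasurable)
    (integrableOn_of_continuous (hslice t) hW)
    (integrableOn_of_continuous (hcont.comp (by fun_prop)) hW).aestronglyMeasurable
    (by filter_upwards [hmem] with x hx s hs using hC (s, x) ⟨hs, hx⟩)
    (integrableOn_of_continuous continuous_const hW)
    (Eventually.of_forall fun x s _ => hderiv s x)).2
  simpa only [(hderiv _ _).deriv] using hmain

end Param

/-! ### Integration by parts against a weight that vanishes on the boundary -/

/-- `truncation n s` vanishes for `n * s ≤ 1` and equals `s` for `2 ≤ n * s`. -/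
def truncation (n : ℕ) (s : ℝ) : ℝ := s * Real.smoothTransition (n * s - 1)

@[fun_prop]
theorem contDiff_truncation (n : ℕ) : ContDiff ℝ ∞ (truncation n) :=
  contDiff_id.mul (Real.smoothTransition.contDiff.comp (by fun_prop))

theorem truncation_eq_zero {n : ℕ} {s : ℝ} (hs : n * s ≤ 1) : truncation n s = 0 := by
  rw [truncation, Real.smoothTransition.zero_of_nonpos (by linarith), mul_zero]

theorem truncation_eq_self {n : ℕ} {s : ℝ} (hs : 2 ≤ n * s) : truncation n s = s := by
  rw [truncation, Real.smoothTransition.one_of_one_le (by linarith), mul_one]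

theorem deriv_truncation_eq_one {n : ℕ} {s : ℝ} (hs : 2 < n * s) : deriv (truncation n) s = 1 := by
  have hid : truncation n =ᶠ[𝓝 s] id := by
    filter_upwards [(continuous_const_mul (n : ℝ)).continuousAt.eventually (lt_mem_nhds hs)]
      with r hr
    exact truncation_eq_self hr.le
  rw [hid.deriv_eq, deriv_id]

theorem abs_truncation_le (n : ℕ) (s : ℝ) : |truncation n s| ≤ |s| := by
  rw [truncation, abs_mul, abs_of_nonneg (Real.smoothTransition.nonneg _)]
  exact mul_le_of_le_one_right (abs_nonneg s) (Real.smoothTransition.le_one _)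

theorem deriv_smoothTransition_eq_zero {r : ℝ} (hr : r ∉ Icc (0 : ℝ) 1) :
    deriv Real.smoothTransition r = 0 := by
  rcases not_and_or.1 hr with h | h
  · have hzero : Real.smoothTransition =ᶠ[𝓝 r] fun _ => 0 := by
      filter_upwards [gt_mem_nhds (not_le.1 h)] with q hq
      exact Real.smoothTransition.zero_of_nonpos hq.le
    rw [hzero.deriv_eq, deriv_const]
  · have hone : Real.smoothTransition =ᶠ[𝓝 r] fun _ => 1 := by
      filter_upwards [lt_mem_nhds (not_le.1 h)] with q hq
      exact Real.smoothTransition.one_of_one_le hq.le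
    rw [hone.deriv_eq, deriv_const]

/-- With `r = n * s - 1`, the derivative is `θ r + (r + 1) * θ' r`, where `θ` is the smooth
transition. -/
theorem exists_forall_abs_deriv_truncation_le : ∃ C, ∀ n s, |deriv (truncation n) s| ≤ C := by
  have hθ : ContDiff ℝ ∞ Real.smoothTransition := Real.smoothTransition.contDiff
  obtain ⟨C, hC⟩ := (isCompact_Icc (a := (0 : ℝ)) (b := 1)).exists_bound_of_continuousOn
    (f := fun r => (r + 1) * deriv Real.smoothTransition r)
    (((continuous_id.add continuous_const).mul (hθ.continuous_deriv (by simp))).continuousOn)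
  refine ⟨1 + max C 0, fun n s => ?_⟩
  have hderiv : deriv (truncation n) s = Real.smoothTransition (n * s - 1)
      + (n * s - 1 + 1) * deriv Real.smoothTransition (n * s - 1) := by
    have hinner : HasDerivAt (fun s : ℝ => n * s - 1) (n * 1) s :=
      ((hasDerivAt_id s).const_mul _).sub_const _
    have hcomp := (hθ.differentiable (by simp) (n * s - 1)).hasDerivAt.comp s hinner
    refine ((hasDerivAt_id s).mul hcomp).deriv.trans ?_
    simp only [comp_def, id]
    ring
  rw [hderiv]
  refine (abs_add_le _ _).trans (add_le_add ?_ ?_)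
  · rw [abs_of_nonneg (Real.smoothTransition.nonneg _)]
    exact Real.smoothTransition.le_one _
  · by_cases hr : (n * s - 1 : ℝ) ∈ Icc (0 : ℝ) 1
    · exact (hC _ hr).trans (le_max_left _ _)
    · simp [deriv_smoothTransition_eq_zero hr]

theorem fderiv_truncation_mul_apply {V : Type*} [NormedAddCommGroup V] [NormedSpace ℝ V]
    {a v : V → ℝ} {x : V} (ha : DifferentiableAt ℝ a x) (hv : DifferentiableAt ℝ v x)
    (n : ℕ) (w : V) :
    fderiv ℝ (fun y => truncation n (a y) * v y) x w
      = deriv (truncation n) (a x) * (fderiv ℝ a x w * v x)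
        + truncation n (a x) * fderiv ℝ v x w := by
  have hT : HasFDerivAt (fun y => truncation n (a y))
      (deriv (truncation n) (a x) • fderiv ℝ a x) x :=
    (((contDiff_truncation n).differentiable (by simp) _).hasDerivAt).comp_hasFDerivAt x
      ha.hasFDerivAt
  rw [fderiv_fun_mul hT.differentiableAt hv, hT.fderiv]
  simp only [add_apply, smul_apply, smul_eq_mul]
  ring

/-- A smooth weight on a bounded open set that is positive inside and vanishes on the boundary, as
the electron density does. Vector fields multiplied by it have no flux through the boundary,
whatever the regularity of the latter. -/
structure IsBoundaryWeight {V : Type*} [NormedAddCommGroup V] [NormedSpace ℝ V] (Ω : Set V)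
    (a : V → ℝ) : Prop where
  isOpen : IsOpen Ω
  isBounded : Bornology.IsBounded Ω
  contDiff : ContDiff ℝ ∞ a
  pos : ∀ x ∈ Ω, 0 < a x
  eq_zero : ∀ x ∈ frontier Ω, a x = 0

namespace IsBoundaryWeight

variable {V : Type*} [NormedAddCommGroup V] [NormedSpace ℝ V] {Ω : Set V} {a : V → ℝ}

theorem isCompact_superlevel [FiniteDimensional ℝ V] (ha : IsBoundaryWeight Ω a) (c : ℝ) :
    IsCompact {x ∈ closure Ω | c ≤ a x} :=
  ha.isBounded.isCompact_closure.inter_right (isClosed_le continuous_const ha.contDiff.continuous)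

theorem superlevel_subset (ha : IsBoundaryWeight Ω a) {c : ℝ} (hc : 0 < c) :
    {x ∈ closure Ω | c ≤ a x} ⊆ Ω := by
  rintro x ⟨hx, hcx⟩
  by_contra hxΩ
  have hfrontier : x ∈ frontier Ω := ha.isOpen.frontier_eq ▸ ⟨hx, hxΩ⟩
  exact absurd (ha.eq_zero x hfrontier) (hc.trans_le hcx).ne'

end IsBoundaryWeight

section BoundaryWeight

variable {V : Type*} [NormedAddCommGroup V] [NormedSpace ℝ V] [FiniteDimensional ℝ V]
  [MeasurableSpace V] [BorelSpace V] {μ : Measure V} [μ.IsAddHaarMeasure] {Ω : Set V}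

theorem integral_fderiv_apply_eq_zero {u : V → ℝ} (hu : ContDiff ℝ 1 u) (hc : HasCompactSupport u)
    (w : V) : ∫ x, fderiv ℝ u x w ∂μ = 0 := by
  have hcont : Continuous fun x => fderiv ℝ u x w :=
    (hu.continuous_fderiv one_ne_zero).clm_apply continuous_const
  have hparts := integral_mul_fderiv_eq_neg_fderiv_mul_of_integrable (μ := μ)
    (f := fun _ => (1 : ℝ)) (g := u) (v := w) (by simp)
    (by simpa only [one_mul] using hcont.integrable_of_hasCompactSupport (hc.fderiv_apply ℝ w))
    (by simpa only [one_mul] using hu.continuous.integrable_of_hasCompactSupport hc)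
    (fun _ _ => differentiableAt_const _) (fun x _ => hu.differentiable one_ne_zero x)
  simpa using hparts

theorem setIntegral_fderiv_apply_eq_zero {K : Set V} (hΩ : IsOpen Ω) (hK : IsCompact K)
    (hKΩ : K ⊆ Ω) {u : V → ℝ} (hu : ContDiff ℝ 1 u) (hu0 : ∀ x ∈ Ω \ K, u x = 0) (w : V) :
    ∫ x in Ω, fderiv ℝ u x w ∂μ = 0 := by
  obtain ⟨ρ, hρ, hρc, hρΩ, hρ_one⟩ := exists_contDiff_cutoff hK hΩ hKΩ
  have heq : EqOn u (fun x => ρ x * u x) Ω := fun x hx => by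
    by_cases hxK : x ∈ K
    · simp [hρ_one x hxK]
    · simp [hu0 x ⟨hx, hxK⟩]
  have hzero (x : V) (hx : x ∉ Ω) : fderiv ℝ (fun x => ρ x * u x) x w = 0 := by
    have hsupp : x ∉ tsupport fun x => ρ x * u x := fun h => hx (hρΩ (tsupport_mul_subset_left h))
    rw [image_eq_zero_of_notMem_tsupport fun h => hsupp (tsupport_fderiv_subset ℝ h)]
    rfl
  calc ∫ x in Ω, fderiv ℝ u x w ∂μ
      = ∫ x in Ω, fderiv ℝ (fun x => ρ x * u x) x w ∂μ :=
        setIntegral_congr_fun hΩ.measurableSet fun x hx => by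
          rw [(heq.eventuallyEq_of_mem (hΩ.mem_nhds hx)).fderiv_eq]
    _ = ∫ x, fderiv ℝ (fun x => ρ x * u x) x w ∂μ :=
        setIntegral_eq_integral_of_forall_compl_eq_zero hzero
    _ = 0 := integral_fderiv_apply_eq_zero ((hρ.of_le (by simp)).mul hu) hρc.mul_right w

theorem IsBoundaryWeight.integrableOn {a : V → ℝ} (ha : IsBoundaryWeight Ω a) {F : Type*}
    [NormedAddCommGroup F] {h : V → F} (hh : Continuous h) : IntegrableOn h Ω μ :=
  integrableOn_of_continuous hh ha.isBounded

theorem IsBoundaryWeight.setIntegral_fderiv_truncation_mul_apply {a v : V → ℝ}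
    (ha : IsBoundaryWeight Ω a) (hv : ContDiff ℝ 1 v) (n : ℕ) (w : V) :
    ∫ x in Ω, fderiv ℝ (fun y => truncation n (a y) * v y) x w ∂μ = 0 := by
  have hsmooth : ContDiff ℝ 1 (fun y => truncation n (a y) * v y) :=
    (((contDiff_truncation n).comp ha.contDiff).of_le (by simp)).mul hv
  refine setIntegral_fderiv_apply_eq_zero ha.isOpen (ha.isCompact_superlevel (n + 1 : ℝ)⁻¹)
    (ha.superlevel_subset (by positivity)) hsmooth (fun x hx => ?_) w
  have hle : a x ≤ (n + 1 : ℝ)⁻¹ := le_of_not_ge fun h => hx.2 ⟨subset_closure hx.1, h⟩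
  have hn : n * a x ≤ 1 :=
    (mul_le_mul_of_nonneg_left hle n.cast_nonneg).trans
      (mul_inv_le_one_of_le₀ (by linarith) (by positivity))
  simp only [truncation_eq_zero hn, zero_mul]

theorem tendsto_fderiv_truncation_mul_apply {V : Type*} [NormedAddCommGroup V] [NormedSpace ℝ V]
    {a v : V → ℝ} {x : V} (ha : DifferentiableAt ℝ a x) (hv : DifferentiableAt ℝ v x)
    (hpos : 0 < a x) (w : V) :
    Tendsto (fun n : ℕ => fderiv ℝ (fun y => truncation n (a y) * v y) x w) atTop
      (𝓝 (fderiv ℝ (fun y => a y * v y) x w)) := by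
  have hlarge : ∀ᶠ n : ℕ in atTop, 2 < n * a x :=
    (tendsto_natCast_atTop_atTop.atTop_mul_const hpos).eventually_gt_atTop 2
  refine tendsto_const_nhds.congr' ?_
  filter_upwards [hlarge] with n hn
  rw [fderiv_truncation_mul_apply ha hv, truncation_eq_self hn.le, deriv_truncation_eq_one hn,
    fderiv_fun_mul ha hv]
  simp only [add_apply, smul_apply, smul_eq_mul]
  ring

/-- The truncations `truncation n ∘ a` of the weight are supported in compact subsets of `Ω`, and
their gradients are bounded uniformly in `n`, so the claim follows by dominated convergence. -/
theorem IsBoundaryWeight.setIntegral_fderiv_mul_apply {a v : V → ℝ} (ha : IsBoundaryWeight Ω a)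
    (hv : ContDiff ℝ ∞ v) (w : V) : ∫ x in Ω, fderiv ℝ (fun y => a y * v y) x w ∂μ = 0 := by
  obtain ⟨C, hC⟩ := exists_forall_abs_deriv_truncation_le
  have hda : ContDiff ℝ ∞ a := ha.contDiff
  have hbound (n : ℕ) (x : V) : ‖fderiv ℝ (fun y => truncation n (a y) * v y) x w‖
      ≤ C * |fderiv ℝ a x w * v x| + |a x * fderiv ℝ v x w| := by
    rw [fderiv_truncation_mul_apply (by fun_prop) (by fun_prop), Real.norm_eq_abs]
    refine (abs_add_le _ _).trans (add_le_add ?_ ?_)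
    · rw [abs_mul]
      exact mul_le_mul_of_nonneg_right (hC _ _) (abs_nonneg _)
    · rw [abs_mul, abs_mul]
      exact mul_le_mul_of_nonneg_right (abs_truncation_le _ _) (abs_nonneg _)
  have hmeas (n : ℕ) : Continuous fun x => fderiv ℝ (fun y => truncation n (a y) * v y) x w := by
    fun_prop
  have hlim : Tendsto (fun n : ℕ => ∫ x in Ω, fderiv ℝ (fun y => truncation n (a y) * v y) x w ∂μ)
      atTop (𝓝 (∫ x in Ω, fderiv ℝ (fun y => a y * v y) x w ∂μ)) :=
    tendsto_integral_of_dominated_convergence _ (fun n => (hmeas n).aestronglyMeasurable)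
      (ha.integrableOn (by fun_prop)) (fun n => Eventually.of_forall (hbound n))
      ((ae_restrict_mem ha.isOpen.measurableSet).mono fun x hx =>
        tendsto_fderiv_truncation_mul_apply (by fun_prop) (by fun_prop) (ha.pos x hx) w)
  simp only [ha.setIntegral_fderiv_truncation_mul_apply (hv.of_le (by simp))] at hlim
  exact tendsto_nhds_unique hlim tendsto_const_nhds

end BoundaryWeight

/-! ### Vector calculus -/

theorem inner_E3 (u v : E3) : inner ℝ u v = u 0 * v 0 + u 1 * v 1 + u 2 * v 2 := by
  simp only [PiLp.inner_apply, Fin.sum_univ_three, RCLike.inner_apply, conj_trivial]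
  ring

theorem ext_E3 {u v : E3} (h0 : u 0 = v 0) (h1 : u 1 = v 1) (h2 : u 2 = v 2) : u = v := by
  ext i
  fin_cases i
  exacts [h0, h1, h2]

@[simp] theorem cross_zero (u v : E3) : cross u v 0 = u 1 * v 2 - u 2 * v 1 := rfl
@[simp] theorem cross_one (u v : E3) : cross u v 1 = u 2 * v 0 - u 0 * v 2 := rfl
@[simp] theorem cross_two (u v : E3) : cross u v 2 = u 0 * v 1 - u 1 * v 0 := rfl

@[simp] theorem grad_apply (f : E3 → ℝ) (x : E3) (i : Fin 3) : grad f x i = pd i f x := by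
  fin_cases i <;> rfl

@[simp] theorem curl_zero (V : E3 → E3) (x : E3) :
    curl V x 0 = pd 1 (fun y => V y 2) x - pd 2 (fun y => V y 1) x := rfl
@[simp] theorem curl_one (V : E3 → E3) (x : E3) :
    curl V x 1 = pd 2 (fun y => V y 0) x - pd 0 (fun y => V y 2) x := rfl
@[simp] theorem curl_two (V : E3 → E3) (x : E3) :
    curl V x 2 = pd 0 (fun y => V y 1) x - pd 1 (fun y => V y 0) x := rfl

theorem cross_smul_left (c : ℝ) (u v : E3) : cross (c • u) v = c • cross u v := by
  apply ext_E3 <;> simp <;> ring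

theorem cross_smul_right (c : ℝ) (u v : E3) : cross u (c • v) = c • cross u v := by
  apply ext_E3 <;> simp <;> ring

theorem cross_add_right (u v w : E3) : cross u (v + w) = cross u v + cross u w := by
  apply ext_E3 <;> simp <;> ring

theorem inner_cross_right (u v w : E3) : inner ℝ u (cross v w) = -inner ℝ (cross v u) w := by
  simp only [inner_E3, cross_zero, cross_one, cross_two]
  ring

theorem inner_cross_self (u v : E3) : inner ℝ u (cross v u) = 0 := by
  simp only [inner_E3, cross_zero, cross_one, cross_two]
  ring

attribute [local fun_prop] ContDiff.inner

section Smoothness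

variable {Z : Type*} [NormedAddCommGroup Z] [NormedSpace ℝ Z] {f : Z → E3 → ℝ} {V : Z → E3 → E3}
  {g : Z → E3}

@[fun_prop]
theorem contDiff_pd {i : Fin 3} (hf : ContDiff ℝ ∞ (uncurry f)) (hg : ContDiff ℝ ∞ g) :
    ContDiff ℝ ∞ (fun z => pd i (f z) (g z)) :=
  (ContDiff.fderiv hf hg (by simp)).clm_apply contDiff_const

@[fun_prop]
theorem contDiff_grad (hf : ContDiff ℝ ∞ (uncurry f)) (hg : ContDiff ℝ ∞ g) :
    ContDiff ℝ ∞ (fun z => grad (f z) (g z)) := by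
  simp only [contDiff_euclidean, grad_apply]
  fun_prop

@[fun_prop]
theorem contDiff_divergence (hV : ContDiff ℝ ∞ (uncurry V)) (hg : ContDiff ℝ ∞ g) :
    ContDiff ℝ ∞ (fun z => divergence (V z) (g z)) := by
  unfold divergence
  fun_prop

@[fun_prop]
theorem contDiff_curl (hV : ContDiff ℝ ∞ (uncurry V)) (hg : ContDiff ℝ ∞ g) :
    ContDiff ℝ ∞ (fun z => curl (V z) (g z)) := by
  refine contDiff_euclidean.2 fun i => ?_
  fin_cases i <;> dsimp [curl] <;> fun_prop

@[fun_prop]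
theorem contDiff_cross {u v : Z → E3} (hu : ContDiff ℝ ∞ u) (hv : ContDiff ℝ ∞ v) :
    ContDiff ℝ ∞ (fun z => cross (u z) (v z)) := by
  refine contDiff_euclidean.2 fun i => ?_
  fin_cases i <;> dsimp [cross] <;> fun_prop

end Smoothness

section EqOn

variable {Ω : Set E3} {x : E3}

theorem pd_eq_of_eqOn (hΩ : IsOpen Ω) {f g : E3 → ℝ} (h : EqOn f g Ω) (hx : x ∈ Ω) (i : Fin 3) :
    pd i f x = pd i g x := by
  rw [pd, pd, (h.eventuallyEq_of_mem (hΩ.mem_nhds hx)).fderiv_eq]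

theorem grad_eq_of_eqOn (hΩ : IsOpen Ω) {f g : E3 → ℝ} (h : EqOn f g Ω) (hx : x ∈ Ω) :
    grad f x = grad g x := by
  simp only [grad, pd_eq_of_eqOn hΩ h hx]

theorem pd_coord_eq_of_eqOn (hΩ : IsOpen Ω) {V W : E3 → E3} (h : EqOn V W Ω) (hx : x ∈ Ω)
    (i j : Fin 3) : pd i (fun y => V y j) x = pd i (fun y => W y j) x :=
  pd_eq_of_eqOn hΩ (fun y hy => by simp only [h hy]) hx i

theorem divergence_eq_of_eqOn (hΩ : IsOpen Ω) {V W : E3 → E3} (h : EqOn V W Ω) (hx : x ∈ Ω) :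
    divergence V x = divergence W x := by
  simp only [divergence, pd_coord_eq_of_eqOn hΩ h hx]

theorem curl_eq_of_eqOn (hΩ : IsOpen Ω) {V W : E3 → E3} (h : EqOn V W Ω) (hx : x ∈ Ω) :
    curl V x = curl W x := by
  simp only [curl, pd_coord_eq_of_eqOn hΩ h hx]

end EqOn

section Rules

variable {f g : E3 → ℝ} {U V : E3 → E3} {x : E3}

theorem pd_add (hf : DifferentiableAt ℝ f x) (hg : DifferentiableAt ℝ g x) (i : Fin 3) :
    pd i (fun y => f y + g y) x = pd i f x + pd i g x := by
  simp only [pd, fderiv_fun_add hf hg, add_apply]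

theorem pd_sub (hf : DifferentiableAt ℝ f x) (hg : DifferentiableAt ℝ g x) (i : Fin 3) :
    pd i (fun y => f y - g y) x = pd i f x - pd i g x := by
  simp only [pd, fderiv_fun_sub hf hg, sub_apply]

theorem pd_mul (hf : DifferentiableAt ℝ f x) (hg : DifferentiableAt ℝ g x) (i : Fin 3) :
    pd i (fun y => f y * g y) x = pd i f x * g x + f x * pd i g x := by
  simp only [pd, fderiv_fun_mul hf hg, add_apply, smul_apply, smul_eq_mul]
  ring

theorem pd_const_mul (hf : DifferentiableAt ℝ f x) (c : ℝ) (i : Fin 3) :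
    pd i (fun y => c * f y) x = c * pd i f x := by
  simp only [pd, fderiv_const_mul hf, smul_apply, smul_eq_mul]

theorem pd_comp {m : ℝ → ℝ} (hm : DifferentiableAt ℝ m (f x)) (hf : DifferentiableAt ℝ f x)
    (i : Fin 3) : pd i (fun y => m (f y)) x = deriv m (f x) * pd i f x := by
  have hcomp := hm.hasDerivAt.comp_hasFDerivAt x hf.hasFDerivAt
  exact DFunLike.congr_fun hcomp.fderiv _

theorem pd_coord (hV : DifferentiableAt ℝ V x) (i j : Fin 3) :
    pd i (fun y => V y j) x = fderiv ℝ V x (EuclideanSpace.single i 1) j := by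
  have hcoord := ((EuclideanSpace.proj j).hasFDerivAt (x := V x)).comp x hV.hasFDerivAt
  exact DFunLike.congr_fun hcoord.fderiv _

theorem pd_comm (hf : ContDiff ℝ ∞ f) (i j : Fin 3) (x : E3) :
    pd i (pd j f) x = pd j (pd i f) x :=
  fderiv_fderiv_apply_comm hf x _ _

theorem grad_add_const_mul (hf : DifferentiableAt ℝ f x) (hg : DifferentiableAt ℝ g x) (c : ℝ) :
    grad (fun y => f y + c * g y) x = grad f x + c • grad g x := by
  ext i
  simp [pd_add hf (hg.const_mul c), pd_const_mul hg]

theorem grad_comp {m : ℝ → ℝ} (hm : DifferentiableAt ℝ m (f x)) (hf : DifferentiableAt ℝ f x) :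
    grad (fun y => m (f y)) x = deriv m (f x) • grad f x := by
  ext i
  simp [pd_comp hm hf]

theorem divergence_add_const_smul (hU : DifferentiableAt ℝ U x) (hV : DifferentiableAt ℝ V x)
    (c : ℝ) : divergence (fun y => U y + c • V y) x = divergence U x + c * divergence V x := by
  simp only [divergence, PiLp.add_apply, PiLp.smul_apply, smul_eq_mul, Finset.mul_sum,
    ← Finset.sum_add_distrib]
  refine Finset.sum_congr rfl fun i _ => ?_
  rw [pd_add (by fun_prop) (by fun_prop), pd_const_mul (by fun_prop)]

theorem divergence_smul (hf : DifferentiableAt ℝ f x) (hV : DifferentiableAt ℝ V x) :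
    divergence (fun y => f y • V y) x = f x * divergence V x + inner ℝ (grad f x) (V x) := by
  have hpd (i : Fin 3) : pd i (fun y => (f y • V y) i) x
      = pd i f x * V x i + f x * pd i (fun y => V y i) x := pd_mul hf (by fun_prop) i
  simp only [divergence, Fin.sum_univ_three, hpd, inner_E3, grad_apply]
  ring

theorem divergence_cross (hU : DifferentiableAt ℝ U x) (hV : DifferentiableAt ℝ V x) :
    divergence (fun y => cross (U y) (V y)) x
      = inner ℝ (curl U x) (V x) - inner ℝ (U x) (curl V x) := by
  have hpd (i j k : Fin 3) : pd i (fun y => U y j * V y k - U y k * V y j) x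
      = pd i (fun y => U y j) x * V x k + U x j * pd i (fun y => V y k) x
        - (pd i (fun y => U y k) x * V x j + U x k * pd i (fun y => V y j) x) := by
    rw [pd_sub (by fun_prop) (by fun_prop), pd_mul (by fun_prop) (by fun_prop),
      pd_mul (by fun_prop) (by fun_prop)]
  simp only [divergence, Fin.sum_univ_three, cross_zero, cross_one, cross_two, hpd, inner_E3,
    curl_zero, curl_one, curl_two]
  ring

theorem curl_smul (hf : DifferentiableAt ℝ f x) (hV : DifferentiableAt ℝ V x) :
    curl (fun y => f y • V y) x = f x • curl V x + cross (grad f x) (V x) := by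
  have hpd (i j : Fin 3) : pd i (fun y => (f y • V y) j) x
      = pd i f x * V x j + f x * pd i (fun y => V y j) x := pd_mul hf (by fun_prop) i
  apply ext_E3 <;> simp only [curl_zero, curl_one, curl_two, hpd] <;>
    simp only [curl_zero, curl_one, curl_two, PiLp.add_apply, PiLp.smul_apply, smul_eq_mul,
      cross_zero, cross_one, cross_two, grad_apply] <;>
    ring

theorem curl_grad (hf : ContDiff ℝ ∞ f) (x : E3) : curl (grad f) x = 0 := by
  apply ext_E3 <;> simpa [sub_eq_zero] using pd_comm hf _ _ x

end Rules

/-! ### The bracket of scalar fields -/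

/-- The drift velocity `β × ∇f`; with `β = B / B²` it is the velocity `v^χ` of the equation. -/
def drift (β : E3 → E3) (f : E3 → ℝ) (x : E3) : E3 := cross (β x) (grad f x)

/-- The bracket `∇f · (β × ∇g)` of two scalar fields, which is the integrand of the brackets of
functionals. -/
def fieldBracket (β : E3 → E3) (f g : E3 → ℝ) (x : E3) : ℝ := inner ℝ (grad f x) (drift β g x)

section Smoothness

variable {Z : Type*} [NormedAddCommGroup Z] [NormedSpace ℝ Z] {β : Z → E3 → E3}
  {f g : Z → E3 → ℝ} {h : Z → E3}

@[fun_prop]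
theorem contDiff_drift (hβ : ContDiff ℝ ∞ (uncurry β)) (hf : ContDiff ℝ ∞ (uncurry f))
    (hh : ContDiff ℝ ∞ h) : ContDiff ℝ ∞ (fun z => drift (β z) (f z) (h z)) := by
  unfold drift
  fun_prop

@[fun_prop]
theorem contDiff_fieldBracket (hβ : ContDiff ℝ ∞ (uncurry β)) (hf : ContDiff ℝ ∞ (uncurry f))
    (hg : ContDiff ℝ ∞ (uncurry g)) (hh : ContDiff ℝ ∞ h) :
    ContDiff ℝ ∞ (fun z => fieldBracket (β z) (f z) (g z) (h z)) := by
  unfold fieldBracket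
  fun_prop

end Smoothness

section FieldBracket

variable (β : E3 → E3) {f g h : E3 → ℝ} {x : E3}

theorem fieldBracket_antisymm (f g : E3 → ℝ) (x : E3) :
    fieldBracket β f g x = -fieldBracket β g f x := by
  rw [fieldBracket, fieldBracket, drift, drift, inner_cross_right, real_inner_comm]

theorem fieldBracket_self (f : E3 → ℝ) (x : E3) : fieldBracket β f f x = 0 := by
  linarith [fieldBracket_antisymm β f f x]

theorem fieldBracket_const (c : ℝ) (g : E3 → ℝ) (x : E3) :
    fieldBracket β (fun _ => c) g x = 0 := by
  have hgrad : grad (fun _ => c) x = 0 := by ext i; simp [pd]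
  rw [fieldBracket, hgrad, inner_zero_left]

theorem fieldBracket_comp {m : ℝ → ℝ} (hm : DifferentiableAt ℝ m (f x))
    (hf : DifferentiableAt ℝ f x) (g : E3 → ℝ) :
    fieldBracket β (fun y => m (f y)) g x = deriv m (f x) * fieldBracket β f g x := by
  rw [fieldBracket, grad_comp hm hf, real_inner_smul_left, fieldBracket]

theorem fieldBracket_eq_of_eqOn {Ω : Set E3} (hΩ : IsOpen Ω) {f' g' : E3 → ℝ} (hf : EqOn f f' Ω)
    (hg : EqOn g g' Ω) (hx : x ∈ Ω) : fieldBracket β f g x = fieldBracket β f' g' x := by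
  simp only [fieldBracket, drift, grad_eq_of_eqOn hΩ hf hx, grad_eq_of_eqOn hΩ hg hx]

theorem fieldBracket_expand (f g : E3 → ℝ) (x : E3) :
    fieldBracket β f g x = pd 0 f x * (β x 1 * pd 2 g x - β x 2 * pd 1 g x)
      + pd 1 f x * (β x 2 * pd 0 g x - β x 0 * pd 2 g x)
      + pd 2 f x * (β x 0 * pd 1 g x - β x 1 * pd 0 g x) := by
  simp only [fieldBracket, drift, inner_E3, cross_zero, cross_one, cross_two, grad_apply]

theorem fieldBracket_linear (hf : DifferentiableAt ℝ f x) (hg : DifferentiableAt ℝ g x)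
    (c d : ℝ) (h : E3 → ℝ) : fieldBracket β (fun y => c * f y + d * g y) h x
      = c * fieldBracket β f h x + d * fieldBracket β g h x := by
  have hpd (i : Fin 3) : pd i (fun y => c * f y + d * g y) x = c * pd i f x + d * pd i g x := by
    rw [pd_add (by fun_prop) (by fun_prop), pd_const_mul hf, pd_const_mul hg]
  simp only [fieldBracket_expand, hpd]
  ring

variable {β}

theorem pd_fieldBracket (hβ : ContDiff ℝ ∞ β) (hf : ContDiff ℝ ∞ f) (hg : ContDiff ℝ ∞ g)
    (i : Fin 3) (x : E3) :
    pd i (fieldBracket β f g) x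
      = fieldBracket (fun y => fderiv ℝ β y (EuclideanSpace.single i 1)) f g x
        + fieldBracket β (pd i f) g x + fieldBracket β f (pd i g) x := by
  have hterm (j k l : Fin 3) : pd i (fun y => pd j f y * (β y k * pd l g y - β y l * pd k g y)) x
      = pd j (pd i f) x * (β x k * pd l g x - β x l * pd k g x)
        + pd j f x * (pd i (fun y => β y k) x * pd l g x + β x k * pd l (pd i g) x
          - (pd i (fun y => β y l) x * pd k g x + β x l * pd k (pd i g) x)) := by
    rw [pd_mul (by fun_prop) (by fun_prop), pd_sub (by fun_prop) (by fun_prop),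
      pd_mul (by fun_prop) (by fun_prop), pd_mul (by fun_prop) (by fun_prop), pd_comm hf i j,
      pd_comm hg i l, pd_comm hg i k]
  rw [funext (fieldBracket_expand β f g), pd_add (by fun_prop) (by fun_prop),
    pd_add (by fun_prop) (by fun_prop), hterm, hterm, hterm]
  simp only [fieldBracket_expand, pd_coord (differentiableAt_of_contDiff_infty hβ x)]
  ring

/-- The second derivatives cancel, and the rest is `(β · ∇ × β) (∇f · ∇g × ∇h)`. -/
theorem fieldBracket_jacobi (hβ : ContDiff ℝ ∞ β) (hf : ContDiff ℝ ∞ f) (hg : ContDiff ℝ ∞ g)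
    (hh : ContDiff ℝ ∞ h) (hx : inner ℝ (β x) (curl β x) = 0) :
    fieldBracket β (fieldBracket β f g) h x + fieldBracket β (fieldBracket β g h) f x
      + fieldBracket β (fieldBracket β h f) g x = 0 := by
  rw [fieldBracket_expand, fieldBracket_expand β (fieldBracket β g h),
    fieldBracket_expand β (fieldBracket β h f)]
  simp only [pd_fieldBracket hβ hf hg, pd_fieldBracket hβ hg hh, pd_fieldBracket hβ hh hf]
  simp only [fieldBracket_expand, ← pd_coord (differentiableAt_of_contDiff_infty hβ x)]
  simp only [pd_comm hf 1 0, pd_comm hf 2 0, pd_comm hf 2 1, pd_comm hg 1 0, pd_comm hg 2 0,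
    pd_comm hg 2 1, pd_comm hh 1 0, pd_comm hh 2 0, pd_comm hh 2 1]
  simp only [inner_E3, curl_zero, curl_one, curl_two] at hx
  linear_combination (pd 0 f x * (pd 1 g x * pd 2 h x - pd 2 g x * pd 1 h x)
    + pd 1 f x * (pd 2 g x * pd 0 h x - pd 0 g x * pd 2 h x)
    + pd 2 f x * (pd 0 g x * pd 1 h x - pd 1 g x * pd 0 h x)) * hx

end FieldBracket

/-! ### The elliptic operator -/

/-- The operator `𝒟f = λ a f + σ ∇ · (a β × (β × ∇f))`, with coefficients `a = A_e` and
`β = B / B²` defined on the whole space. -/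
def elliptic (a : E3 → ℝ) (β : E3 → E3) (lam sig : ℝ) (f : E3 → ℝ) (x : E3) : ℝ :=
  lam * a x * f x + sig * divergence (fun y => a y • cross (β y) (drift β f y)) x

/-- The vorticity `λ f - σ β · ∇ × (β × ∇f)`, which is `𝒟f / a` under the integrability
condition `∇ × (a β) = 0`. -/
def vorticity (β : E3 → E3) (lam sig : ℝ) (f : E3 → ℝ) (x : E3) : ℝ :=
  lam * f x - sig * inner ℝ (β x) (curl (drift β f) x)

section Smoothness

variable {Z : Type*} [NormedAddCommGroup Z] [NormedSpace ℝ Z] {a : E3 → ℝ} {β : E3 → E3}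
  {lam sig : ℝ} {f : Z → E3 → ℝ} {h : Z → E3}

@[fun_prop]
theorem contDiff_elliptic (ha : ContDiff ℝ ∞ a) (hβ : ContDiff ℝ ∞ β)
    (hf : ContDiff ℝ ∞ (uncurry f)) (hh : ContDiff ℝ ∞ h) :
    ContDiff ℝ ∞ (fun z => elliptic a β lam sig (f z) (h z)) := by
  unfold elliptic
  fun_prop

@[fun_prop]
theorem contDiff_vorticity (hβ : ContDiff ℝ ∞ β) (hf : ContDiff ℝ ∞ (uncurry f))
    (hh : ContDiff ℝ ∞ h) : ContDiff ℝ ∞ (fun z => vorticity β lam sig (f z) (h z)) := by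
  unfold vorticity
  fun_prop

end Smoothness

section Elliptic

variable {Ω : Set E3} {a : E3 → ℝ} {β : E3 → E3} {f g : E3 → ℝ}

theorem elliptic_add_const_mul (ha : ContDiff ℝ ∞ a) (hβ : ContDiff ℝ ∞ β) (lam sig : ℝ)
    (hf : ContDiff ℝ ∞ f) (hg : ContDiff ℝ ∞ g) (c : ℝ) (x : E3) :
    elliptic a β lam sig (fun y => f y + c * g y) x
      = elliptic a β lam sig f x + c * elliptic a β lam sig g x := by
  have hflux (y : E3) : a y • cross (β y) (drift β (fun z => f z + c * g z) y)
      = a y • cross (β y) (drift β f y) + c • (a y • cross (β y) (drift β g y)) := by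
    simp only [drift, grad_add_const_mul (differentiableAt_of_contDiff_infty hf y)
      (differentiableAt_of_contDiff_infty hg y), cross_add_right, cross_smul_right, smul_add,
      smul_comm c]
  simp only [elliptic, hflux]
  rw [divergence_add_const_smul (by fun_prop) (by fun_prop)]
  ring

namespace IsBoundaryWeight

theorem setIntegral_divergence_smul (ha : IsBoundaryWeight Ω a) {V : E3 → E3}
    (hV : ContDiff ℝ ∞ V) : ∫ x in Ω, divergence (fun y => a y • V y) x = 0 := by
  have ha' := ha.contDiff
  simp only [divergence]
  rw [integral_finsetSum _ fun i _ => ha.integrableOn (by fun_prop)]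
  exact Finset.sum_eq_zero fun i _ =>
    ha.setIntegral_fderiv_mul_apply (v := fun y => V y i) (by fun_prop) _

theorem setIntegral_mul_divergence (ha : IsBoundaryWeight Ω a) (hf : ContDiff ℝ ∞ f)
    {V : E3 → E3} (hV : ContDiff ℝ ∞ V) : ∫ x in Ω, f x * divergence (fun y => a y • V y) x
      = -∫ x in Ω, a x * inner ℝ (grad f x) (V x) := by
  have ha' := ha.contDiff
  have hproduct (x : E3) : divergence (fun y => a y • f y • V y) x
      = f x * divergence (fun y => a y • V y) x + a x * inner ℝ (grad f x) (V x) := by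
    simp only [smul_comm (a _) (f _)]
    rw [divergence_smul (by fun_prop) (by fun_prop), real_inner_smul_right]
  have hzero := ha.setIntegral_divergence_smul (V := fun y => f y • V y) (hf.smul hV)
  simp only [hproduct] at hzero
  rw [integral_add (ha.integrableOn (by fun_prop)) (ha.integrableOn (by fun_prop))] at hzero
  linarith

theorem setIntegral_mul_elliptic (ha : IsBoundaryWeight Ω a) (hβ : ContDiff ℝ ∞ β) (lam sig : ℝ)
    (hf : ContDiff ℝ ∞ f) (hg : ContDiff ℝ ∞ g) :
    ∫ x in Ω, f x * elliptic a β lam sig g x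
      = ∫ x in Ω, a x * (lam * (f x * g x) + sig * inner ℝ (drift β f x) (drift β g x)) := by
  have ha' := ha.contDiff
  have hparts : ∫ x in Ω, f x * divergence (fun y => a y • cross (β y) (drift β g y)) x
      = ∫ x in Ω, a x * inner ℝ (drift β f x) (drift β g x) := by
    rw [ha.setIntegral_mul_divergence hf (by fun_prop), ← integral_neg]
    congr with x
    rw [inner_cross_right, ← drift]
    ring
  calc ∫ x in Ω, f x * elliptic a β lam sig g x
      = ∫ x in Ω, (a x * (lam * (f x * g x))
          + sig * (f x * divergence (fun y => a y • cross (β y) (drift β g y)) x)) := by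
        congr with x
        rw [elliptic]
        ring
    _ = ∫ x in Ω, (a x * (lam * (f x * g x))
          + sig * (a x * inner ℝ (drift β f x) (drift β g x))) := by
        rw [integral_add (ha.integrableOn (by fun_prop)) (ha.integrableOn (by fun_prop)),
          integral_add (ha.integrableOn (by fun_prop)) (ha.integrableOn (by fun_prop)),
          integral_const_mul, integral_const_mul, hparts]
    _ = _ := by
        congr with x
        ring

theorem eqOn_zero_of_setIntegral_mul_elliptic (ha : IsBoundaryWeight Ω a) (hβ : ContDiff ℝ ∞ β)
    {lam sig : ℝ} (hlam : 0 < lam) (hsig : 0 ≤ sig) (hf : ContDiff ℝ ∞ f)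
    (h0 : ∫ x in Ω, f x * elliptic a β lam sig f x = 0) : EqOn f 0 Ω := by
  have ha' := ha.contDiff
  rw [ha.setIntegral_mul_elliptic hβ lam sig hf hf] at h0
  have hnonneg (x : E3) : 0 ≤ sig * inner ℝ (drift β f x) (drift β f x) :=
    mul_nonneg hsig real_inner_self_nonneg
  have hae := (setIntegral_eq_zero_iff_of_nonneg_ae
    ((ae_restrict_iff' ha.isOpen.measurableSet).2 (.of_forall fun x hx =>
      mul_nonneg (ha.pos x hx).le (add_nonneg
        (mul_nonneg hlam.le (mul_self_nonneg (f x))) (hnonneg x))))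
    (ha.integrableOn (by fun_prop))).1 h0
  intro x hx
  have hzero := Measure.eqOn_open_of_ae_eq (μ := volume) hae ha.isOpen
    (Continuous.continuousOn (by fun_prop)) continuousOn_const hx
  simp only [Pi.zero_apply, mul_eq_zero, (ha.pos x hx).ne', false_or] at hzero
  have hsq : lam * (f x * f x) = 0 :=
    le_antisymm (by linarith [hnonneg x]) (mul_nonneg hlam.le (mul_self_nonneg _))
  simpa [hlam.ne'] using hsq

end IsBoundaryWeight

theorem eqOn_zero_of_forall_setIntegral_testFunctions (hΩ : IsOpen Ω) {h : E3 → ℝ}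
    (hh : Continuous h) (h0 : ∀ φ ∈ TestFunctions Ω, ∫ x in Ω, φ x * h x = 0) : EqOn h 0 Ω := by
  have hae := hΩ.ae_eq_zero_of_integral_contDiff_smul_eq_zero (μ := volume)
    (hh.locallyIntegrable.locallyIntegrableOn Ω) (fun φ hφ hφc hφΩ => by
      rw [← h0 φ ⟨hφ, hφc, hφΩ⟩]
      refine (setIntegral_eq_integral_of_forall_compl_eq_zero fun y hy => ?_).symm
      simp [image_eq_zero_of_notMem_tsupport fun hy' => hy (hφΩ hy')])
  exact Measure.eqOn_open_of_ae_eq ((ae_restrict_iff' hΩ.measurableSet).2 hae) hΩ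
    hh.continuousOn continuousOn_const

end Elliptic

/-! ### The integrability condition -/

section Integrability

variable {a : E3 → ℝ} {β : E3 → E3} {x : E3}

theorem inner_curl_eq_zero (ha : ContDiff ℝ ∞ a) (hβ : ContDiff ℝ ∞ β) (hx : a x ≠ 0)
    (hI : curl (fun y => a y • β y) x = 0) : inner ℝ (β x) (curl β x) = 0 := by
  have hinner := congrArg (inner ℝ (β x)) hI
  rw [curl_smul (by fun_prop) (by fun_prop), inner_add_right, inner_cross_self, add_zero,
    real_inner_smul_right, inner_zero_right] at hinner
  exact (mul_eq_zero.1 hinner).resolve_left hx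

theorem divergence_smul_cross (ha : ContDiff ℝ ∞ a) (hβ : ContDiff ℝ ∞ β)
    (hI : curl (fun y => a y • β y) x = 0) {V : E3 → E3} (hV : ContDiff ℝ ∞ V) :
    divergence (fun y => a y • cross (β y) (V y)) x = -(a x * inner ℝ (β x) (curl V x)) := by
  simp only [← cross_smul_left]
  rw [divergence_cross (U := fun y => a y • β y) (by fun_prop) (by fun_prop), hI, inner_zero_left,
    real_inner_smul_left, zero_sub]

theorem elliptic_eq_mul_vorticity (ha : ContDiff ℝ ∞ a) (hβ : ContDiff ℝ ∞ β)
    (hI : curl (fun y => a y • β y) x = 0) (lam sig : ℝ) {f : E3 → ℝ} (hf : ContDiff ℝ ∞ f) :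
    elliptic a β lam sig f x = a x * vorticity β lam sig f x := by
  rw [elliptic, divergence_smul_cross ha hβ hI (by fun_prop), vorticity]
  ring

theorem divergence_mul_smul_drift (ha : ContDiff ℝ ∞ a) (hβ : ContDiff ℝ ∞ β)
    (hI : curl (fun y => a y • β y) x = 0) {m g : E3 → ℝ} (hm : ContDiff ℝ ∞ m)
    (hg : ContDiff ℝ ∞ g) :
    divergence (fun y => (a y * m y) • drift β g y) x = a x * fieldBracket β m g x := by
  have hzero : divergence (fun y => a y • drift β g y) x = 0 := by
    simp only [drift]
    rw [divergence_smul_cross ha hβ hI (by fun_prop), curl_grad hg, inner_zero_right, mul_zero,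
      neg_zero]
  simp only [mul_comm (a _) (m _), mul_smul]
  rw [divergence_smul (by fun_prop) (by fun_prop), hzero, mul_zero, zero_add,
    real_inner_smul_right, fieldBracket]

theorem IsBoundaryWeight.setIntegral_mul_fieldBracket {Ω : Set E3} (ha : IsBoundaryWeight Ω a)
    (hβ : ContDiff ℝ ∞ β) (hI : ∀ x ∈ Ω, curl (fun y => a y • β y) x = 0) {m f g : E3 → ℝ}
    (hm : ContDiff ℝ ∞ m) (hf : ContDiff ℝ ∞ f) (hg : ContDiff ℝ ∞ g) :
    ∫ x in Ω, a x * m x * fieldBracket β f g x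
      = -∫ x in Ω, f x * (a x * fieldBracket β m g x) := by
  calc ∫ x in Ω, a x * m x * fieldBracket β f g x
      = ∫ x in Ω, a x * inner ℝ (grad f x) (m x • drift β g x) := by
        congr with x
        rw [real_inner_smul_right, fieldBracket, mul_assoc]
    _ = -∫ x in Ω, f x * divergence (fun y => a y • m y • drift β g y) x := by
        rw [ha.setIntegral_mul_divergence hf (by fun_prop), neg_neg]
    _ = _ := by
        congr 1
        refine setIntegral_congr_fun ha.isOpen.measurableSet fun x hx => ?_
        simp only [smul_smul, divergence_mul_smul_drift ha.contDiff hβ (hI x hx) hm hg]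

end Integrability

/-! ### Fields that are smooth up to the boundary -/

section SmoothUpTo

variable {Ω : Set E3}

theorem exists_contDiff_eqOn {V : Type*} [NormedAddCommGroup V] [NormedSpace ℝ V]
    (hΩ : Bornology.IsBounded Ω) {f : E3 → V} (hf : SmoothUpTo Ω f) :
    ∃ g : E3 → V, ContDiff ℝ ∞ g ∧ EqOn f g (closure Ω) := by
  obtain ⟨U, hU, hΩU, hfU⟩ := hf
  obtain ⟨ρ, hρ, -, hρU, hρ_one⟩ := exists_contDiff_cutoff hΩ.isCompact_closure hU hΩU
  exact ⟨_, contDiff_smul_of_tsupport_subset hU hρ hfU hρU,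
    fun x hx => by simp only [hρ_one x hx, one_smul]⟩

theorem mem_smoothBar_iff (hΩ : Bornology.IsBounded Ω) {u : E3 → ℝ} :
    u ∈ SmoothBar Ω ↔ (∀ x ∉ Ω, u x = 0) ∧ ∃ f : E3 → ℝ, ContDiff ℝ ∞ f ∧ EqOn u f Ω := by
  refine and_congr Iff.rfl ⟨?_, ?_⟩
  · rintro ⟨f, hf, huf⟩
    obtain ⟨g, hg, hfg⟩ := exists_contDiff_eqOn hΩ hf
    exact ⟨g, hg, huf.trans (hfg.mono subset_closure)⟩
  · rintro ⟨f, hf, huf⟩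
    exact ⟨f, ⟨univ, isOpen_univ, subset_univ _, hf.contDiffOn⟩, huf⟩

theorem smoothFamilyOn_univ_iff {P : Type*} [NormedAddCommGroup P] [NormedSpace ℝ P]
    (hΩ : Bornology.IsBounded Ω) {p : P → E3 → ℝ} :
    SmoothFamilyOn Ω univ p ↔ (∀ s, ∀ x ∉ Ω, p s x = 0) ∧
      ∃ f : P → E3 → ℝ, ContDiff ℝ ∞ (uncurry f) ∧ ∀ s, EqOn (p s) (f s) Ω := by
  refine and_congr (by simp) ⟨?_, ?_⟩
  · rintro ⟨U, f, hU, hΩU, hf, hpf⟩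
    obtain ⟨ρ, hρ, -, hρU, hρ_one⟩ := exists_contDiff_cutoff hΩ.isCompact_closure hU hΩU
    refine ⟨fun s x => ρ x • f (s, x), ?_, fun s x hx => ?_⟩
    · exact contDiff_smul_of_tsupport_subset (ρ := fun z : P × E3 => ρ z.2) (isOpen_univ.prod hU)
        (hρ.comp contDiff_snd) hf fun z hz =>
          ⟨mem_univ _, hρU (tsupport_comp_subset_preimage ρ continuous_snd hz)⟩
    · simp only [hρ_one x (subset_closure hx), one_smul, hpf s (mem_univ s) x hx]
  · rintro ⟨f, hf, hpf⟩
    exact ⟨univ, uncurry f, isOpen_univ, subset_univ _, hf.contDiffOn, fun s _ x hx => hpf s hx⟩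

end SmoothUpTo

/-! ### Regular settings -/

/-- The standing hypotheses on a setting, with functions `a` and `β` that are smooth on the whole
space and represent `A_e` and `B / B²` in `Ω`. -/
structure Setting.IsRegular (S : Setting) (a : E3 → ℝ) (β : E3 → E3) : Prop where
  weight : IsBoundaryWeight S.Ω a
  contDiff_β : ContDiff ℝ ∞ β
  lam_pos : 0 < S.lam
  sig_pos : 0 < S.sig
  A_eq : ∀ x ∈ S.Ω, S.A x = a x
  b_eq : ∀ x ∈ S.Ω, S.b x = β x
  B_ne : ∀ x ∈ S.Ω, S.B x ≠ 0
  X_subset : (S.X : Set (E3 → ℝ)) ⊆ SmoothBar S.Ω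
  test_subset : TestFunctions S.Ω ⊆ (S.X : Set (E3 → ℝ))

theorem Setting.smoothUpTo_b (S : Setting) (hB : SmoothUpTo S.Ω S.B)
    (hB0 : ∀ x ∈ closure S.Ω, S.B x ≠ 0) : SmoothUpTo S.Ω S.b := by
  obtain ⟨U, hU, hΩU, hBU⟩ := hB
  refine ⟨U ∩ S.B ⁻¹' {0}ᶜ, hBU.continuousOn.isOpen_inter_preimage hU isOpen_compl_singleton,
    fun x hx => ⟨hΩU hx, hB0 x hx⟩, ?_⟩
  have hB' := hBU.mono (inter_subset_left (s := U) (t := S.B ⁻¹' {0}ᶜ))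
  exact ((hB'.norm_sq ℝ).inv fun x hx => by simpa using hx.2).smul hB'

theorem Setting.exists_isRegular (S : Setting) (hΩ : IsOpen S.Ω) (hΩb : Bornology.IsBounded S.Ω)
    (hlam : 0 < S.lam) (hsig : 0 < S.sig) (hA : SmoothUpTo S.Ω S.A)
    (hApos : ∀ x ∈ S.Ω, 0 < S.A x) (hA0 : ∀ x ∈ frontier S.Ω, S.A x = 0)
    (hB : SmoothUpTo S.Ω S.B) (hB0 : ∀ x ∈ closure S.Ω, S.B x ≠ 0)
    (hX : (S.X : Set (E3 → ℝ)) ⊆ SmoothBar S.Ω)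
    (hXtest : TestFunctions S.Ω ⊆ (S.X : Set (E3 → ℝ))) : ∃ a β, S.IsRegular a β := by
  obtain ⟨a, ha, hAa⟩ := exists_contDiff_eqOn hΩb hA
  obtain ⟨β, hβ, hbβ⟩ := exists_contDiff_eqOn hΩb (S.smoothUpTo_b hB hB0)
  exact ⟨a, β,
    { weight :=
        { isOpen := hΩ
          isBounded := hΩb
          contDiff := ha
          pos := fun x hx => hAa (subset_closure hx) ▸ hApos x hx
          eq_zero := fun x hx => hAa (frontier_subset_closure hx) ▸ hA0 x hx }
      contDiff_β := hβ
      lam_pos := hlam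
      sig_pos := hsig
      A_eq := fun x hx => hAa (subset_closure hx)
      b_eq := fun x hx => hbβ (subset_closure hx)
      B_ne := fun x hx => hB0 x (subset_closure hx)
      X_subset := hX
      test_subset := hXtest }⟩

namespace Setting.IsRegular

variable {S : Setting} {a : E3 → ℝ} {β : E3 → E3}

section Representatives

variable (R : S.IsRegular a β)
include R

theorem isOpen : IsOpen S.Ω := R.weight.isOpen

theorem isBounded : Bornology.IsBounded S.Ω := R.weight.isBounded

theorem contDiff_a : ContDiff ℝ ∞ a := R.weight.contDiff

theorem integrableOn {h : E3 → ℝ} (hh : Continuous h) : IntegrableOn h S.Ω :=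
  R.weight.integrableOn hh

theorem setIntegral_congr {u v : E3 → ℝ} (h : EqOn u v S.Ω) :
    ∫ x in S.Ω, u x = ∫ x in S.Ω, v x :=
  setIntegral_congr_fun R.isOpen.measurableSet h

theorem exists_rep {u : E3 → ℝ} (hu : u ∈ SmoothBar S.Ω) :
    ∃ f : E3 → ℝ, ContDiff ℝ ∞ f ∧ EqOn u f S.Ω :=
  ((mem_smoothBar_iff R.isBounded).1 hu).2

theorem exists_rep_of_mem {χ : E3 → ℝ} (hχ : χ ∈ S.X) :
    ∃ f : E3 → ℝ, ContDiff ℝ ∞ f ∧ EqOn χ f S.Ω :=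
  R.exists_rep (R.X_subset hχ)

variable {χ f : E3 → ℝ} {x : E3}

theorem vE_eq (h : EqOn χ f S.Ω) (hx : x ∈ S.Ω) : S.vE χ x = drift β f x := by
  rw [vE, drift, ← R.b_eq x hx, b, cross_smul_left, grad_eq_of_eqOn R.isOpen h hx]

theorem inner_curl_vE (h : EqOn χ f S.Ω) (hx : x ∈ S.Ω) :
    inner ℝ (S.B x) (curl (S.vE χ) x) / ‖S.B x‖ ^ 2 = inner ℝ (β x) (curl (drift β f) x) := by
  rw [curl_eq_of_eqOn R.isOpen (fun y hy => R.vE_eq h hy) hx, ← R.b_eq x hx, b,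
    real_inner_smul_left, div_eq_inv_mul]

theorem zeta_eq (h : EqOn χ f S.Ω) (hx : x ∈ S.Ω) :
    S.zeta χ x = 1 - S.sig * inner ℝ (β x) (curl (drift β f) x) := by
  rw [zeta, R.inner_curl_vE h hx]

theorem rhs_eq (h : EqOn χ f S.Ω) (hx : x ∈ S.Ω) :
    S.rhs χ x = divergence (fun y =>
      (a y * (S.sig * inner ℝ (β y) (curl (drift β f) y) - 1)) • drift β f y) x := by
  refine divergence_eq_of_eqOn R.isOpen (fun y hy => ?_) hx
  simp only [R.inner_curl_vE h hy, R.vE_eq h hy, R.A_eq y hy]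

theorem omega_eq (h : EqOn χ f S.Ω) (hx : x ∈ S.Ω) :
    S.omega χ x = -divergence (fun y => a y • cross (β y) (drift β f y)) x := by
  have hflux : EqOn (fun y => (S.A y / ‖S.B y‖ ^ 2) • S.gradPerp χ y)
      (fun y => -(a y • cross (β y) (drift β f y))) S.Ω := fun y hy => by
    simp only [gradPerp, drift, ← R.b_eq y hy, ← R.A_eq y hy, b, cross_smul_left,
      cross_smul_right, grad_eq_of_eqOn R.isOpen h hy, smul_neg, div_eq_mul_inv, mul_smul]
  rw [omega, divergence_eq_of_eqOn R.isOpen hflux hx]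
  simp [divergence, pd]

theorem D_eq (h : EqOn χ f S.Ω) (hx : x ∈ S.Ω) : S.D χ x = elliptic a β S.lam S.sig f x := by
  rw [D, indicator_of_mem hx, R.omega_eq h hx, R.A_eq x hx, h hx, elliptic]
  ring

theorem setIntegral_mul_D {u g : E3 → ℝ} (hu : EqOn u g S.Ω) (h : EqOn χ f S.Ω) :
    ∫ x in S.Ω, u x * S.D χ x = ∫ x in S.Ω, g x * elliptic a β S.lam S.sig f x :=
  R.setIntegral_congr fun x hx => by simp only [hu hx, R.D_eq h hx]

end Representatives

section Operator

variable (R : S.IsRegular a β) {χ ξ : E3 → ℝ}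
include R

theorem D_add_smul (hχ : χ ∈ SmoothBar S.Ω) (hξ : ξ ∈ SmoothBar S.Ω) (c : ℝ) :
    S.D (χ + c • ξ) = S.D χ + c • S.D ξ := by
  obtain ⟨f, hf, hχf⟩ := R.exists_rep hχ
  obtain ⟨g, hg, hξg⟩ := R.exists_rep hξ
  ext x
  by_cases hx : x ∈ S.Ω
  · rw [R.D_eq (f := fun y => f y + c * g y) (fun y hy => by simp [hχf hy, hξg hy]) hx,
      elliptic_add_const_mul R.contDiff_a R.contDiff_β _ _ hf hg]
    simp [R.D_eq hχf hx, R.D_eq hξg hx]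
  · simp [D, hx]

theorem setIntegral_mul_D_comm (hχ : χ ∈ SmoothBar S.Ω) (hξ : ξ ∈ SmoothBar S.Ω) :
    ∫ x in S.Ω, χ x * S.D ξ x = ∫ x in S.Ω, ξ x * S.D χ x := by
  obtain ⟨f, hf, hχf⟩ := R.exists_rep hχ
  obtain ⟨g, hg, hξg⟩ := R.exists_rep hξ
  rw [R.setIntegral_mul_D hχf hξg, R.setIntegral_mul_D hξg hχf,
    R.weight.setIntegral_mul_elliptic R.contDiff_β _ _ hf hg,
    R.weight.setIntegral_mul_elliptic R.contDiff_β _ _ hg hf]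
  simp only [real_inner_comm, mul_comm]

theorem eq_zero_of_setIntegral_mul_D (hχ : χ ∈ SmoothBar S.Ω)
    (h0 : ∫ x in S.Ω, χ x * S.D χ x = 0) : χ = 0 := by
  obtain ⟨f, hf, hχf⟩ := R.exists_rep hχ
  rw [R.setIntegral_mul_D hχf hχf] at h0
  have hzero := R.weight.eqOn_zero_of_setIntegral_mul_elliptic R.contDiff_β R.lam_pos
    R.sig_pos.le hf h0
  ext x
  by_cases hx : x ∈ S.Ω
  · rw [hχf hx, hzero hx]
  · exact hχ.1 x hx

end Operator

end Setting.IsRegular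

/-! ### Functional derivatives -/

theorem Setting.mem_observables (S : Setting) {F : Functional} (g : (E3 → ℝ) → (E3 → ℝ))
    (hg : ∀ χ ∈ S.X, S.HasFunDeriv F (S.D χ) (g (S.D χ)))
    (hfam : ∀ (k : ℕ) (p : (Fin k → ℝ) → E3 → ℝ), SmoothFamilyOn S.Ω univ p → (∀ s, p s ∈ S.X) →
      SmoothFamilyOn S.Ω univ (fun s => g (S.D (p s)))) : F ∈ S.Observables :=
  ⟨g, forall_mem_image.2 hg, hfam⟩

namespace Setting.IsRegular

variable {S : Setting} {a : E3 → ℝ} {β : E3 → E3}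

section Uniqueness

variable (R : S.IsRegular a β) {F : Functional} {u v χ : E3 → ℝ}
include R

theorem smoothBar_add_smul (hu : u ∈ SmoothBar S.Ω) (hv : v ∈ SmoothBar S.Ω) (c d : ℝ) :
    c • u + d • v ∈ SmoothBar S.Ω := by
  obtain ⟨hu0, f, hf, huf⟩ := (mem_smoothBar_iff R.isBounded).1 hu
  obtain ⟨hv0, g, hg, hvg⟩ := (mem_smoothBar_iff R.isBounded).1 hv
  exact (mem_smoothBar_iff R.isBounded).2 ⟨fun x hx => by simp [hu0 x hx, hv0 x hx],
    fun x => c * f x + d * g x, by fun_prop, fun x hx => by simp [huf hx, hvg hx]⟩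

theorem smoothBar_sub (hu : u ∈ SmoothBar S.Ω) (hv : v ∈ SmoothBar S.Ω) :
    u - v ∈ SmoothBar S.Ω := by
  simpa [sub_eq_add_neg] using R.smoothBar_add_smul hu hv 1 (-1)

theorem D_sub (hu : u ∈ SmoothBar S.Ω) (hv : v ∈ SmoothBar S.Ω) :
    S.D (u - v) = S.D u - S.D v := by
  simpa [sub_eq_add_neg] using R.D_add_smul hu hv (-1)

theorem integrableOn_mul_D (hu : u ∈ SmoothBar S.Ω) (hv : v ∈ SmoothBar S.Ω) :
    IntegrableOn (fun x => u x * S.D v x) S.Ω := by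
  obtain ⟨f, hf, huf⟩ := R.exists_rep hu
  obtain ⟨g, hg, hvg⟩ := R.exists_rep hv
  have ha := R.contDiff_a
  have hβ := R.contDiff_β
  have hint : IntegrableOn (fun x => f x * elliptic a β S.lam S.sig g x) S.Ω :=
    R.integrableOn (by fun_prop)
  exact hint.congr_fun (fun x hx => by simp only [huf hx, R.D_eq hvg hx]) R.isOpen.measurableSet

theorem eq_zero_of_forall_setIntegral_mul_D (hu : u ∈ SmoothBar S.Ω)
    (h : ∀ φ ∈ TestFunctions S.Ω, ∫ x in S.Ω, u x * S.D φ x = 0) : u = 0 := by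
  obtain ⟨f, hf, huf⟩ := R.exists_rep hu
  have ha := R.contDiff_a
  have hβ := R.contDiff_β
  have hzero : EqOn (elliptic a β S.lam S.sig f) 0 S.Ω :=
    eqOn_zero_of_forall_setIntegral_testFunctions R.isOpen (by fun_prop) fun φ hφ => by
      rw [← h φ hφ, R.setIntegral_mul_D_comm hu (R.X_subset (R.test_subset hφ)),
        R.setIntegral_mul_D (eqOn_refl φ _) huf]
  refine R.eq_zero_of_setIntegral_mul_D hu (setIntegral_eq_zero_of_forall_eq_zero fun x hx => ?_)
  rw [R.D_eq huf hx, hzero hx, Pi.zero_apply, mul_zero]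

theorem injOn_D : InjOn S.D (S.X : Set (E3 → ℝ)) := by
  intro χ hχ ξ hξ h
  refine sub_eq_zero.1 (R.eq_zero_of_setIntegral_mul_D
    (R.smoothBar_sub (R.X_subset hχ) (R.X_subset hξ)) ?_)
  rw [R.D_sub (R.X_subset hχ) (R.X_subset hξ), h]
  simp

theorem Dinv_D (hχ : χ ∈ S.X) : S.Dinv (S.D χ) = χ :=
  R.injOn_D.leftInvOn_invFunOn hχ

theorem hasFunDeriv_unique {η : E3 → ℝ} (hu : S.HasFunDeriv F η u) (hv : S.HasFunDeriv F η v) :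
    u = v := by
  refine sub_eq_zero.1 (R.eq_zero_of_forall_setIntegral_mul_D (R.smoothBar_sub hu.1 hv.1)
    fun φ hφ => ?_)
  have hφX := R.test_subset hφ
  have heq := (hu.2 _ (mem_image_of_mem _ hφX)).unique (hv.2 _ (mem_image_of_mem _ hφX))
  simp only [Pi.sub_apply, sub_mul]
  rw [integral_sub (R.integrableOn_mul_D hu.1 (R.X_subset hφX))
    (R.integrableOn_mul_D hv.1 (R.X_subset hφX)), heq, sub_self]

theorem funDeriv_eq {η : E3 → ℝ} (h : S.HasFunDeriv F η u) : S.funDeriv F η = u := by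
  have hex : ∃ u, S.HasFunDeriv F η u := ⟨u, h⟩
  rw [funDeriv, dif_pos hex]
  exact R.hasFunDeriv_unique hex.choose_spec h

theorem hasFunDeriv_funDeriv (hF : F ∈ S.Observables) (hχ : χ ∈ S.X) :
    S.HasFunDeriv F (S.D χ) (S.funDeriv F (S.D χ)) := by
  obtain ⟨g, hg, -⟩ := hF
  have hgχ := hg _ (mem_image_of_mem _ hχ)
  rwa [R.funDeriv_eq hgχ]

theorem exists_rep_funDeriv (hF : F ∈ S.Observables) (hχ : χ ∈ S.X) :
    ∃ f : E3 → ℝ, ContDiff ℝ ∞ f ∧ EqOn (S.funDeriv F (S.D χ)) f S.Ω :=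
  R.exists_rep (R.hasFunDeriv_funDeriv hF hχ).1

end Uniqueness

section ChainRule

variable (R : S.IsRegular a β) {P : Type*} [NormedAddCommGroup P] [NormedSpace ℝ P]
  {F : Functional}
include R

theorem smoothFamily_comp {Q : Type*} [NormedAddCommGroup Q] [NormedSpace ℝ Q] {p : P → E3 → ℝ}
    (hp : SmoothFamilyOn S.Ω univ p) {ψ : Q → P} (hψ : ContDiff ℝ ∞ ψ) :
    SmoothFamilyOn S.Ω univ (fun s => p (ψ s)) := by
  obtain ⟨hp0, f, hf, hpf⟩ := (smoothFamilyOn_univ_iff R.isBounded).1 hp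
  exact (smoothFamilyOn_univ_iff R.isBounded).2 ⟨fun s => hp0 _, fun s => f (ψ s), by fun_prop,
    fun s => hpf _⟩

theorem smoothFamily_funDeriv [FiniteDimensional ℝ P] (hF : F ∈ S.Observables) {p : P → E3 → ℝ}
    (hp : SmoothFamilyOn S.Ω univ p) (hpX : ∀ s, p s ∈ S.X) :
    SmoothFamilyOn S.Ω univ (fun s => S.funDeriv F (S.D (p s))) := by
  have e : P ≃L[ℝ] (Fin (Module.finrank ℝ P) → ℝ) :=
    ContinuousLinearEquiv.ofFinrankEq (by simp)
  obtain ⟨g, hg, hfam⟩ := hF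
  have hge := hfam _ _ (R.smoothFamily_comp hp e.symm.contDiff) fun s => hpX _
  have hFg (s : P) : S.funDeriv F (S.D (p s)) = g (S.D (p (e.symm (e s)))) := by
    rw [e.symm_apply_apply]
    exact R.funDeriv_eq (hg _ (mem_image_of_mem _ (hpX s)))
  simp only [hFg]
  exact R.smoothFamily_comp hge e.contDiff

theorem hasDerivAt_comp_D_line (hF : F ∈ S.Observables) {χ ξ : E3 → ℝ} (hχ : χ ∈ S.X)
    (hξ : ξ ∈ S.X) (r : ℝ) : HasDerivAt (fun r : ℝ => F (S.D (χ + r • ξ)))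
      (∫ x in S.Ω, S.funDeriv F (S.D (χ + r • ξ)) x * S.D ξ x) r := by
  have hmem : χ + r • ξ ∈ S.X := S.X.add_mem hχ (S.X.smul_mem r hξ)
  have hderiv := (R.hasFunDeriv_funDeriv hF hmem).2 _ (mem_image_of_mem _ hξ)
  have hshift (s : ℝ) : S.D (χ + r • ξ) + s • S.D ξ = S.D (χ + (r + s) • ξ) := by
    rw [← R.D_add_smul (R.X_subset hmem) (R.X_subset hξ), add_smul, add_assoc]
  simp only [hshift] at hderiv
  rw [← sub_self r] at hderiv
  simpa using hderiv.comp_sub_const r r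

theorem comp_D_add_eq_integral (hF : F ∈ S.Observables) {χ ξ : E3 → ℝ} (hχ : χ ∈ S.X)
    (hξ : ξ ∈ S.X) {φ : ℝ → E3 → ℝ} (hφ : ContDiff ℝ ∞ (uncurry φ))
    (hFφ : ∀ r : ℝ, EqOn (S.funDeriv F (S.D (χ + r • ξ))) (φ r) S.Ω) :
    F (S.D (χ + ξ)) = F (S.D χ) + ∫ r in Ioc (0 : ℝ) 1, ∫ x in S.Ω, φ r x * S.D ξ x := by
  obtain ⟨f, hf, hξf⟩ := R.exists_rep_of_mem hξ
  have ha := R.contDiff_a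
  have hβ := R.contDiff_β
  have hcont : Continuous fun r : ℝ => ∫ x in S.Ω, φ r x * S.D ξ x := by
    simp only [R.setIntegral_mul_D (eqOn_refl (φ _) _) hξf]
    exact (contDiff_setIntegral (h := fun r x => φ r x * elliptic a β S.lam S.sig f x)
      (by fun_prop) R.isOpen.measurableSet R.isBounded).continuous
  have hderiv (r : ℝ) : HasDerivAt (fun r : ℝ => F (S.D (χ + r • ξ)))
      (∫ x in S.Ω, φ r x * S.D ξ x) r := by
    rw [← R.setIntegral_congr fun x hx => congrArg (· * S.D ξ x) (hFφ r hx)]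
    exact R.hasDerivAt_comp_D_line hF hχ hξ r
  rw [← intervalIntegral.integral_of_le zero_le_one,
    intervalIntegral.integral_eq_sub_of_hasDerivAt (fun r _ => hderiv r)
      (hcont.intervalIntegrable _ _)]
  simp

/-- Integrating the functional derivative along the segment from `p s₀` to `p s` expresses
`F (𝒟 (p s))` through integrals of jointly smooth functions. -/
theorem exists_comp_D_eq_integral [FiniteDimensional ℝ P] (hF : F ∈ S.Observables)
    {p f : P → E3 → ℝ} (hp0 : ∀ s, ∀ x ∉ S.Ω, p s x = 0) (hf : ContDiff ℝ ∞ (uncurry f))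
    (hpf : ∀ s, EqOn (p s) (f s) S.Ω) (hpX : ∀ s, p s ∈ S.X) (s₀ : P) :
    ∃ φ : P × ℝ → E3 → ℝ, ContDiff ℝ ∞ (uncurry φ) ∧
      (∀ r, EqOn (S.funDeriv F (S.D (p s₀))) (φ (s₀, r)) S.Ω) ∧
      ∀ s, F (S.D (p s)) = F (S.D (p s₀)) + ∫ r in Ioc (0 : ℝ) 1, ∫ x in S.Ω,
        φ (s, r) x * (elliptic a β S.lam S.sig (f s) x - elliptic a β S.lam S.sig (f s₀) x) := by
  have hsegment : SmoothFamilyOn S.Ω univ (fun z : P × ℝ => p s₀ + z.2 • (p z.1 - p s₀)) :=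
    (smoothFamilyOn_univ_iff R.isBounded).2 ⟨fun z x hx => by simp [hp0 _ x hx],
      fun z x => f s₀ x + z.2 * (f z.1 x - f s₀ x), by fun_prop, fun z x hx => by simp [hpf _ hx]⟩
  have hsub (s : P) : p s - p s₀ ∈ S.X := S.X.sub_mem (hpX s) (hpX s₀)
  obtain ⟨-, φ, hφ, hFφ⟩ := (smoothFamilyOn_univ_iff R.isBounded).1
    (R.smoothFamily_funDeriv hF hsegment
      fun z => S.X.add_mem (hpX s₀) (S.X.smul_mem _ (hsub z.1)))
  refine ⟨φ, hφ, fun r => by simpa using hFφ (s₀, r), fun s => ?_⟩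
  have hline := R.comp_D_add_eq_integral hF (hpX s₀) (hsub s) (φ := fun r => φ (s, r))
    (by fun_prop) fun r => hFφ (s, r)
  rw [add_sub_cancel] at hline
  rw [hline]
  congr 2 with r
  refine R.setIntegral_congr fun x hx => ?_
  simp only [R.D_sub (R.X_subset (hpX s)) (R.X_subset (hpX s₀)), Pi.sub_apply, R.D_eq (hpf _) hx]

theorem contDiff_comp_D [FiniteDimensional ℝ P] (hF : F ∈ S.Observables) {p : P → E3 → ℝ}
    (hp : SmoothFamilyOn S.Ω univ p) (hpX : ∀ s, p s ∈ S.X) :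
    ContDiff ℝ ∞ (fun s => F (S.D (p s))) := by
  obtain ⟨hp0, f, hf, hpf⟩ := (smoothFamilyOn_univ_iff R.isBounded).1 hp
  obtain ⟨φ, hφ, -, hformula⟩ := R.exists_comp_D_eq_integral hF hp0 hf hpf hpX 0
  have ha := R.contDiff_a
  have hβ := R.contDiff_β
  have hinner := contDiff_setIntegral (μ := volume) (h := fun (z : P × ℝ) x => φ z x *
    (elliptic a β S.lam S.sig (f z.1) x - elliptic a β S.lam S.sig (f 0) x)) (by fun_prop)
    R.isOpen.measurableSet R.isBounded
  rw [funext hformula]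
  exact contDiff_const.add (contDiff_setIntegral (h := fun s r => ∫ x in S.Ω, φ (s, r) x *
    (elliptic a β S.lam S.sig (f s) x - elliptic a β S.lam S.sig (f 0) x)) hinner
    measurableSet_Ioc (Metric.isBounded_Ioc 0 1))

theorem hasDerivAt_comp_D (hF : F ∈ S.Observables) {p : ℝ → E3 → ℝ}
    (hp : SmoothFamilyOn S.Ω univ p) (hpX : ∀ s, p s ∈ S.X) (t : ℝ) :
    HasDerivAt (fun s => F (S.D (p s)))
      (∫ x in S.Ω, S.funDeriv F (S.D (p t)) x * deriv (fun s => S.D (p s) x) t) t := by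
  obtain ⟨hp0, f, hf, hpf⟩ := (smoothFamilyOn_univ_iff R.isBounded).1 hp
  obtain ⟨φ, hφ, hφt, hformula⟩ := R.exists_comp_D_eq_integral hF hp0 hf hpf hpX t
  have ha := R.contDiff_a
  have hβ := R.contDiff_β
  have hinner := contDiff_setIntegral (μ := volume) (h := fun (z : ℝ × ℝ) x => φ z x *
    (elliptic a β S.lam S.sig (f z.1) x - elliptic a β S.lam S.sig (f t) x)) (by fun_prop)
    R.isOpen.measurableSet R.isBounded
  have hderiv (r : ℝ) : deriv (fun s => ∫ x in S.Ω, φ (s, r) x *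
      (elliptic a β S.lam S.sig (f s) x - elliptic a β S.lam S.sig (f t) x)) t
      = ∫ x in S.Ω, S.funDeriv F (S.D (p t)) x * deriv (fun s => S.D (p s) x) t := by
    rw [(hasDerivAt_setIntegral (h := fun s x => φ (s, r) x * (elliptic a β S.lam S.sig (f s) x
      - elliptic a β S.lam S.sig (f t) x)) (ContDiff.of_le (n := ∞) (by fun_prop) (by simp))
      R.isBounded t).deriv]
    refine R.setIntegral_congr fun x hx => ?_
    have hdiff : ContDiff ℝ ∞ fun s => elliptic a β S.lam S.sig (f s) x := by fun_prop
    simp only [R.D_eq (hpf _) hx, hφt r hx]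
    rw [deriv_fun_mul (by fun_prop) ((differentiableAt_of_contDiff_infty hdiff t).sub_const _),
      sub_self, mul_zero, zero_add, deriv_sub_const]
  have houter := hasDerivAt_setIntegral (μ := volume) (h := fun s r => ∫ x in S.Ω, φ (s, r) x *
    (elliptic a β S.lam S.sig (f s) x - elliptic a β S.lam S.sig (f t) x))
    (hinner.of_le (by simp)) (Metric.isBounded_Ioc (0 : ℝ) 1) t
  simp only [hderiv] at houter
  rw [funext hformula]
  simpa using houter.const_add (F (S.D (p t)))

end ChainRule

end Setting.IsRegular

/-! ### Antisymmetric brackets -/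

/-- The bracket `∫ K ∇F_η · (B/B²) × ∇G_η dx` of functionals, with a weight `K` that depends on the
state `η`. Both brackets of the theorem have this form. -/
def Setting.weightedBracket (S : Setting) (K : (E3 → ℝ) → E3 → ℝ) (F G : Functional) :
    Functional := fun η =>
  ∫ x in S.Ω, K η x *
    inner ℝ (grad (S.funDeriv F η) x) (cross (S.b x) (grad (S.funDeriv G η) x))

theorem Setting.weightedBracket_antisymm (S : Setting) (K : (E3 → ℝ) → E3 → ℝ)
    (F G : Functional) (η : E3 → ℝ) :
    S.weightedBracket K F G η = -S.weightedBracket K G F η := by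
  rw [weightedBracket, weightedBracket, ← integral_neg]
  congr 1 with x
  rw [inner_cross_right, real_inner_comm, mul_neg]

namespace Setting.IsRegular

variable {S : Setting} {a : E3 → ℝ} {β : E3 → E3}

section Algebra

variable (R : S.IsRegular a β) {F G : Functional}
include R

theorem setIntegral_add_smul_mul_D {u v ξ : E3 → ℝ} (hu : u ∈ SmoothBar S.Ω)
    (hv : v ∈ SmoothBar S.Ω) (hξ : ξ ∈ SmoothBar S.Ω) (c d : ℝ) :
    ∫ x in S.Ω, (c • u + d • v) x * S.D ξ x
      = c * (∫ x in S.Ω, u x * S.D ξ x) + d * ∫ x in S.Ω, v x * S.D ξ x := by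
  rw [← integral_const_mul, ← integral_const_mul, ← integral_add
    ((R.integrableOn_mul_D hu hξ).const_mul c) ((R.integrableOn_mul_D hv hξ).const_mul d)]
  congr 1 with x
  simp only [Pi.add_apply, Pi.smul_apply, smul_eq_mul]
  ring

theorem hasFunDeriv_linear {η f g : E3 → ℝ} (hF : S.HasFunDeriv F η f)
    (hG : S.HasFunDeriv G η g) (c d : ℝ) :
    S.HasFunDeriv (c • F + d • G) η (c • f + d • g) := by
  refine ⟨R.smoothBar_add_smul hF.1 hG.1 c d, ?_⟩
  rintro _ ⟨ξ, hξ, rfl⟩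
  rw [R.setIntegral_add_smul_mul_D hF.1 hG.1 (R.X_subset hξ)]
  exact ((hF.2 _ (mem_image_of_mem _ hξ)).const_mul c).add
    ((hG.2 _ (mem_image_of_mem _ hξ)).const_mul d)

theorem hasFunDeriv_mul {η f g : E3 → ℝ} (hF : S.HasFunDeriv F η f)
    (hG : S.HasFunDeriv G η g) : S.HasFunDeriv (F * G) η (G η • f + F η • g) := by
  refine ⟨R.smoothBar_add_smul hF.1 hG.1 _ _, ?_⟩
  rintro _ ⟨ξ, hξ, rfl⟩
  rw [R.setIntegral_add_smul_mul_D hF.1 hG.1 (R.X_subset hξ)]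
  have hderiv := (hF.2 _ (mem_image_of_mem _ hξ)).mul (hG.2 _ (mem_image_of_mem _ hξ))
  simp only [zero_smul, add_zero] at hderiv
  exact hderiv.congr_deriv (by ring)

theorem smoothFamily_linear {P : Type*} [NormedAddCommGroup P] [NormedSpace ℝ P]
    {p q : P → E3 → ℝ} {c d : P → ℝ} (hp : SmoothFamilyOn S.Ω univ p)
    (hq : SmoothFamilyOn S.Ω univ q) (hc : ContDiff ℝ ∞ c) (hd : ContDiff ℝ ∞ d) :
    SmoothFamilyOn S.Ω univ (fun s => c s • p s + d s • q s) := by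
  obtain ⟨hp0, f, hf, hpf⟩ := (smoothFamilyOn_univ_iff R.isBounded).1 hp
  obtain ⟨hq0, g, hg, hqg⟩ := (smoothFamilyOn_univ_iff R.isBounded).1 hq
  exact (smoothFamilyOn_univ_iff R.isBounded).2 ⟨fun s x hx => by simp [hp0 s x hx, hq0 s x hx],
    fun s x => c s * f s x + d s * g s x, by fun_prop, fun s x hx => by simp [hpf s hx, hqg s hx]⟩

theorem linear_mem_observables (hF : F ∈ S.Observables) (hG : G ∈ S.Observables) (c d : ℝ) :
    c • F + d • G ∈ S.Observables :=
  S.mem_observables (fun η => c • S.funDeriv F η + d • S.funDeriv G η)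
    (fun _ hχ => R.hasFunDeriv_linear (R.hasFunDeriv_funDeriv hF hχ)
      (R.hasFunDeriv_funDeriv hG hχ) c d)
    fun _ _ hp hpX => R.smoothFamily_linear (R.smoothFamily_funDeriv hF hp hpX)
      (R.smoothFamily_funDeriv hG hp hpX) contDiff_const contDiff_const

theorem mul_mem_observables (hF : F ∈ S.Observables) (hG : G ∈ S.Observables) :
    F * G ∈ S.Observables :=
  S.mem_observables (fun η => G η • S.funDeriv F η + F η • S.funDeriv G η)
    (fun _ hχ => R.hasFunDeriv_mul (R.hasFunDeriv_funDeriv hF hχ) (R.hasFunDeriv_funDeriv hG hχ))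
    fun _ _ hp hpX => R.smoothFamily_linear (R.smoothFamily_funDeriv hF hp hpX)
      (R.smoothFamily_funDeriv hG hp hpX) (R.contDiff_comp_D hG hp hpX)
      (R.contDiff_comp_D hF hp hpX)

end Algebra

section WeightedBracket

variable (R : S.IsRegular a β) {K : (E3 → ℝ) → E3 → ℝ} {F G H E : Functional}
include R

theorem weightedBracket_eq {η k f g : E3 → ℝ} (hk : EqOn (K η) k S.Ω)
    (hf : EqOn (S.funDeriv F η) f S.Ω) (hg : EqOn (S.funDeriv G η) g S.Ω) :
    S.weightedBracket K F G η = ∫ x in S.Ω, k x * fieldBracket β f g x :=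
  R.setIntegral_congr fun x hx => by
    rw [← fieldBracket_eq_of_eqOn β R.isOpen hf hg hx, fieldBracket, drift, ← R.b_eq x hx, hk hx]

theorem weightedBracket_linear
    (hK : ∀ χ ∈ S.X, ∃ k : E3 → ℝ, ContDiff ℝ ∞ k ∧ EqOn (K (S.D χ)) k S.Ω)
    (hF : F ∈ S.Observables) (hG : G ∈ S.Observables) (hH : H ∈ S.Observables) {χ : E3 → ℝ}
    (hχ : χ ∈ S.X) {c d : ℝ}
    (hE : S.HasFunDeriv E (S.D χ) (c • S.funDeriv F (S.D χ) + d • S.funDeriv G (S.D χ))) :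
    S.weightedBracket K E H (S.D χ)
      = c * S.weightedBracket K F H (S.D χ) + d * S.weightedBracket K G H (S.D χ) := by
  have hβ := R.contDiff_β
  obtain ⟨k, hk, hKk⟩ := hK χ hχ
  obtain ⟨f, hf, hFf⟩ := R.exists_rep_funDeriv hF hχ
  obtain ⟨g, hg, hGg⟩ := R.exists_rep_funDeriv hG hχ
  obtain ⟨h, hh, hHh⟩ := R.exists_rep_funDeriv hH hχ
  have hEe : EqOn (S.funDeriv E (S.D χ)) (fun y => c * f y + d * g y) S.Ω := fun x hx => by
    rw [R.funDeriv_eq hE]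
    simp [hFf hx, hGg hx]
  rw [R.weightedBracket_eq hKk hEe hHh, R.weightedBracket_eq hKk hFf hHh,
    R.weightedBracket_eq hKk hGg hHh, ← integral_const_mul, ← integral_const_mul,
    ← integral_add (R.integrableOn (by fun_prop)) (R.integrableOn (by fun_prop))]
  congr 1 with x
  rw [fieldBracket_linear β (by fun_prop) (by fun_prop)]
  ring

theorem isAntisymmetricBracket_weightedBracket
    (hK : ∀ χ ∈ S.X, ∃ k : E3 → ℝ, ContDiff ℝ ∞ k ∧ EqOn (K (S.D χ)) k S.Ω) :
    IsAntisymmetricBracket S.Phase S.Observables (S.weightedBracket K) where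
  linear_mem F hF G hG c d := R.linear_mem_observables hF hG c d
  mul_mem F hF G hG := R.mul_mem_observables hF hG
  linear_left := by
    rintro F hF G hG H hH c d _ ⟨χ, hχ, rfl⟩
    exact R.weightedBracket_linear hK hF hG hH hχ (R.hasFunDeriv_linear
      (R.hasFunDeriv_funDeriv hF hχ) (R.hasFunDeriv_funDeriv hG hχ) c d)
  linear_right := by
    rintro F hF G hG H hH c d _ ⟨χ, hχ, rfl⟩
    rw [S.weightedBracket_antisymm K H, S.weightedBracket_antisymm K H F,
      S.weightedBracket_antisymm K H G, R.weightedBracket_linear hK hF hG hH hχ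
      (R.hasFunDeriv_linear (R.hasFunDeriv_funDeriv hF hχ) (R.hasFunDeriv_funDeriv hG hχ) c d)]
    ring
  alternating F _ η _ := self_eq_neg.1 (S.weightedBracket_antisymm K F F η)
  antisymm F _ G _ η _ := S.weightedBracket_antisymm K F G η
  leibniz := by
    rintro F hF G hG H hH _ ⟨χ, hχ, rfl⟩
    rw [R.weightedBracket_linear hK hF hG hH hχ (R.hasFunDeriv_mul
      (R.hasFunDeriv_funDeriv hF hχ) (R.hasFunDeriv_funDeriv hG hχ))]
    ring

theorem isAntisymmetricBracket_bracket :
    IsAntisymmetricBracket S.Phase S.Observables S.bracket := by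
  have ha := R.contDiff_a
  have hβ := R.contDiff_β
  refine R.isAntisymmetricBracket_weightedBracket
    (K := fun η x => S.A x * S.zeta (S.Dinv η) x) fun χ hχ => ?_
  obtain ⟨f, hf, hχf⟩ := R.exists_rep_of_mem hχ
  refine ⟨fun x => a x * (1 - S.sig * inner ℝ (β x) (curl (drift β f) x)), by fun_prop,
    fun x hx => ?_⟩
  simp only [R.Dinv_D hχ, R.zeta_eq hχf hx, R.A_eq x hx]

theorem isAntisymmetricBracket_bracket' :
    IsAntisymmetricBracket S.Phase S.Observables S.bracket' := by
  have ha := R.contDiff_a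
  have hβ := R.contDiff_β
  refine R.isAntisymmetricBracket_weightedBracket (K := fun η => η) fun χ hχ => ?_
  obtain ⟨f, hf, hχf⟩ := R.exists_rep_of_mem hχ
  exact ⟨elliptic a β S.lam S.sig f, by fun_prop, fun x hx => R.D_eq hχf hx⟩

end WeightedBracket

/-! ### Mass, energy and smeared fields -/

section Functionals

variable (R : S.IsRegular a β) {F : Functional}
include R

theorem hasFunDeriv_of_hasDerivAt {χ g : E3 → ℝ} (hχ : χ ∈ S.X) (hg : g ∈ SmoothBar S.Ω)
    (h : ∀ ξ ∈ S.X, HasDerivAt (fun s : ℝ => F (S.D (χ + s • ξ))) (∫ x in S.Ω, g x * S.D ξ x) 0) :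
    S.HasFunDeriv F (S.D χ) g := by
  refine ⟨hg, ?_⟩
  rintro _ ⟨ξ, hξ, rfl⟩
  simpa only [R.D_add_smul (R.X_subset hχ) (R.X_subset hξ)] using h ξ hξ

theorem setIntegral_mul_D_add_smul {u χ ξ : E3 → ℝ} (hu : u ∈ SmoothBar S.Ω)
    (hχ : χ ∈ SmoothBar S.Ω) (hξ : ξ ∈ SmoothBar S.Ω) (s : ℝ) :
    ∫ x in S.Ω, u x * S.D (χ + s • ξ) x
      = (∫ x in S.Ω, u x * S.D χ x) + s * ∫ x in S.Ω, u x * S.D ξ x := by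
  rw [R.D_add_smul hχ hξ, ← integral_const_mul, ← integral_add (R.integrableOn_mul_D hu hχ)
    ((R.integrableOn_mul_D hu hξ).const_mul s)]
  congr 1 with x
  simp only [Pi.add_apply, Pi.smul_apply, smul_eq_mul]
  ring

theorem hasFunDeriv_of_affine {u : E3 → ℝ} (hu : u ∈ SmoothBar S.Ω) {c : ℝ}
    (hF : ∀ χ ∈ S.X, F (S.D χ) = c + ∫ x in S.Ω, u x * S.D χ x) {χ : E3 → ℝ} (hχ : χ ∈ S.X) :
    S.HasFunDeriv F (S.D χ) u := by
  refine R.hasFunDeriv_of_hasDerivAt hχ hu fun ξ hξ => ?_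
  simp only [hF _ (S.X.add_mem hχ (S.X.smul_mem _ hξ)),
    R.setIntegral_mul_D_add_smul hu (R.X_subset hχ) (R.X_subset hξ)]
  simpa using (((hasDerivAt_id (0 : ℝ)).mul_const (∫ x in S.Ω, u x * S.D ξ x)).const_add
    (∫ x in S.Ω, u x * S.D χ x)).const_add c

theorem mem_observables_of_affine {u : E3 → ℝ} (hu : u ∈ SmoothBar S.Ω) {c : ℝ}
    (hF : ∀ χ ∈ S.X, F (S.D χ) = c + ∫ x in S.Ω, u x * S.D χ x) : F ∈ S.Observables := by
  obtain ⟨hu0, f, hf, huf⟩ := (mem_smoothBar_iff R.isBounded).1 hu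
  exact S.mem_observables (fun _ => u) (fun _ hχ => R.hasFunDeriv_of_affine hu hF hχ)
    fun _ _ _ _ => (smoothFamilyOn_univ_iff R.isBounded).2 ⟨fun _ => hu0, fun _ => f,
      by fun_prop, fun _ => huf⟩

theorem indicator_const_mem_smoothBar (c : ℝ) : S.Ω.indicator (fun _ => c) ∈ SmoothBar S.Ω :=
  (mem_smoothBar_iff R.isBounded).2 ⟨fun _ hx => indicator_of_notMem hx _, fun _ => c,
    contDiff_const, fun _ hx => indicator_of_mem hx _⟩

theorem mass_D (c : ℝ) {χ : E3 → ℝ} (hχ : χ ∈ S.X) : S.mass c (S.D χ)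
    = c * (∫ x in S.Ω, a x) + ∫ x in S.Ω, S.Ω.indicator (fun _ => c) x * S.D χ x := by
  have ha := R.contDiff_a
  have hβ := R.contDiff_β
  obtain ⟨f, hf, hχf⟩ := R.exists_rep_of_mem hχ
  have hdrift (x : E3) : drift β (fun _ => c) x = 0 := by
    apply ext_E3 <;> simp [drift, pd]
  rw [R.setIntegral_mul_D (g := fun _ => c) (fun x hx => indicator_of_mem hx _) hχf,
    R.weight.setIntegral_mul_elliptic R.contDiff_β _ _ contDiff_const hf, mass, R.Dinv_D hχ,
    ← integral_const_mul, ← integral_const_mul,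
    ← integral_add (R.integrableOn (by fun_prop)) (R.integrableOn (by fun_prop))]
  refine R.setIntegral_congr fun x hx => ?_
  simp only [R.A_eq x hx, hχf hx, hdrift, inner_zero_left]
  ring

theorem isCasimir_mass (K : (E3 → ℝ) → E3 → ℝ) (c : ℝ) :
    IsCasimir S.Phase S.Observables (S.weightedBracket K) (S.mass c) := by
  have hmem := R.indicator_const_mem_smoothBar c
  refine ⟨R.mem_observables_of_affine hmem fun χ hχ => R.mass_D c hχ, ?_⟩
  rintro G - _ ⟨χ, hχ, rfl⟩
  rw [R.weightedBracket_eq (f := fun _ => c) (eqOn_refl _ _) ?_ (eqOn_refl _ _)]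
  · simp only [fieldBracket_const, mul_zero, integral_zero]
  · rw [R.funDeriv_eq (R.hasFunDeriv_of_affine hmem (fun χ hχ => R.mass_D c hχ) hχ)]
    exact fun x hx => indicator_of_mem hx _

theorem norm_gradPerp_sq_div {χ f : E3 → ℝ} (h : EqOn χ f S.Ω) {x : E3} (hx : x ∈ S.Ω) :
    ‖S.gradPerp χ x‖ ^ 2 / ‖S.B x‖ ^ 2 = inner ℝ (drift β f x) (drift β f x) := by
  have hB : ‖S.B x‖ ^ 2 ≠ 0 := pow_ne_zero 2 (norm_ne_zero_iff.2 (R.B_ne x hx))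
  have hnorm (u v : E3) : ‖cross u (cross u v)‖ ^ 2 = ‖u‖ ^ 2 * ‖cross u v‖ ^ 2 := by
    simp only [← real_inner_self_eq_norm_sq, inner_E3, cross_zero, cross_one, cross_two]
    ring
  rw [← R.vE_eq h hx, vE, gradPerp, norm_neg, norm_smul, mul_pow, hnorm,
    real_inner_self_eq_norm_sq, norm_smul, mul_pow, norm_inv, norm_pow, norm_norm]
  field_simp [hB]

theorem energy_D {χ : E3 → ℝ} (hχ : χ ∈ S.X) :
    S.energy (S.D χ) = 1 / 2 * ∫ x in S.Ω, χ x * S.D χ x := by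
  obtain ⟨f, hf, hχf⟩ := R.exists_rep_of_mem hχ
  rw [R.setIntegral_mul_D hχf hχf, R.weight.setIntegral_mul_elliptic R.contDiff_β _ _ hf hf,
    energy, R.Dinv_D hχ]
  congr 1
  refine R.setIntegral_congr fun x hx => ?_
  simp only [R.norm_gradPerp_sq_div hχf hx, R.A_eq x hx, hχf hx]
  ring

/-- The energy is the quadratic form of the symmetric operator `𝒟`. -/
theorem energy_D_add_smul {χ ξ : E3 → ℝ} (hχ : χ ∈ S.X) (hξ : ξ ∈ S.X) (s : ℝ) :
    S.energy (S.D (χ + s • ξ)) = S.energy (S.D χ) + s * (∫ x in S.Ω, χ x * S.D ξ x)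
      + s ^ 2 * S.energy (S.D ξ) := by
  have hsum := S.X.add_mem hχ (S.X.smul_mem s hξ)
  rw [R.energy_D hsum, R.energy_D hχ, R.energy_D hξ,
    R.setIntegral_mul_D_add_smul (R.X_subset hsum) (R.X_subset hχ) (R.X_subset hξ),
    R.setIntegral_mul_D_comm (R.X_subset hsum) (R.X_subset hχ),
    R.setIntegral_mul_D_comm (R.X_subset hsum) (R.X_subset hξ),
    R.setIntegral_mul_D_add_smul (R.X_subset hχ) (R.X_subset hχ) (R.X_subset hξ),
    R.setIntegral_mul_D_add_smul (R.X_subset hξ) (R.X_subset hχ) (R.X_subset hξ),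
    R.setIntegral_mul_D_comm (R.X_subset hξ) (R.X_subset hχ)]
  ring

theorem hasFunDeriv_energy {χ : E3 → ℝ} (hχ : χ ∈ S.X) : S.HasFunDeriv S.energy (S.D χ) χ := by
  refine R.hasFunDeriv_of_hasDerivAt hχ (R.X_subset hχ) fun ξ hξ => ?_
  simp only [R.energy_D_add_smul hχ hξ]
  simpa using (((hasDerivAt_id (0 : ℝ)).mul_const (∫ x in S.Ω, χ x * S.D ξ x)).const_add
    (S.energy (S.D χ))).fun_add (((hasDerivAt_id (0 : ℝ)).fun_pow 2).mul_const
    (S.energy (S.D ξ)))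

theorem energy_mem_observables : S.energy ∈ S.Observables := by
  refine S.mem_observables S.Dinv (fun χ hχ => ?_) fun k p hp hpX => ?_
  · rw [R.Dinv_D hχ]
    exact R.hasFunDeriv_energy hχ
  · simpa only [R.Dinv_D (hpX _)] using hp

variable {φ : E3 → ℝ} (hφ : φ ∈ TestFunctions S.Ω)
include hφ

theorem smeared_mem_observables : S.smeared φ ∈ S.Observables :=
  R.mem_observables_of_affine (R.X_subset (R.test_subset hφ)) (c := 0)
    fun _ _ => (zero_add _).symm

theorem funDeriv_smeared {χ : E3 → ℝ} (hχ : χ ∈ S.X) : S.funDeriv (S.smeared φ) (S.D χ) = φ :=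
  R.funDeriv_eq (R.hasFunDeriv_of_affine (R.X_subset (R.test_subset hφ)) (c := 0)
    (fun _ _ => (zero_add _).symm) hχ)

end Functionals

end Setting.IsRegular

/-! ### The integrable case -/

namespace Setting.IsRegular

variable {S : Setting} {a : E3 → ℝ} {β : E3 → E3}

section Integrable

variable (R : S.IsRegular a β) (hI : S.Integrability) {F G : Functional} {χ f : E3 → ℝ} {x : E3}
include R hI

theorem curl_eq_zero (x : E3) (hx : x ∈ S.Ω) : curl (fun y => a y • β y) x = 0 := by
  rw [← hI x hx]
  exact curl_eq_of_eqOn R.isOpen (fun y hy => by simp only [R.A_eq y hy, R.b_eq y hy]) hx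

theorem D_eq_vorticity (hf : ContDiff ℝ ∞ f) (h : EqOn χ f S.Ω) (hx : x ∈ S.Ω) :
    S.D χ x = a x * vorticity β S.lam S.sig f x := by
  rw [R.D_eq h hx,
    elliptic_eq_mul_vorticity R.contDiff_a R.contDiff_β (R.curl_eq_zero hI x hx) _ _ hf]

theorem D_div_A (hf : ContDiff ℝ ∞ f) (h : EqOn χ f S.Ω) (hx : x ∈ S.Ω) :
    S.D χ x / S.A x = vorticity β S.lam S.sig f x := by
  rw [R.D_eq_vorticity hI hf h hx, R.A_eq x hx, mul_div_cancel_left₀ _ (R.weight.pos x hx).ne']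

theorem rhs_eq_neg_fieldBracket (hf : ContDiff ℝ ∞ f) (h : EqOn χ f S.Ω) (hx : x ∈ S.Ω) :
    S.rhs χ x = -(a x * fieldBracket β (vorticity β S.lam S.sig f) f x) := by
  have hβ := R.contDiff_β
  have hflux : (fun y => S.sig * inner ℝ (β y) (curl (drift β f) y) - 1)
      = fun y => -1 * vorticity β S.lam S.sig f y + 1 * (S.lam * f y + -1 * 1) := by
    ext y
    rw [vorticity]
    ring
  rw [R.rhs_eq h hx, divergence_mul_smul_drift R.contDiff_a hβ (R.curl_eq_zero hI x hx)
    (m := fun y => S.sig * inner ℝ (β y) (curl (drift β f) y) - 1) (by fun_prop) hf, hflux,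
    fieldBracket_linear β (by fun_prop) (by fun_prop),
    fieldBracket_linear β (by fun_prop) (by fun_prop), fieldBracket_self, fieldBracket_const]
  ring

theorem bracket'_eq {k g : E3 → ℝ} (hk : ContDiff ℝ ∞ k) (hχ : EqOn χ k S.Ω)
    (hf : EqOn (S.funDeriv F (S.D χ)) f S.Ω) (hg : EqOn (S.funDeriv G (S.D χ)) g S.Ω) :
    S.bracket' F G (S.D χ)
      = ∫ x in S.Ω, a x * vorticity β S.lam S.sig k x * fieldBracket β f g x :=
  R.weightedBracket_eq (K := fun η => η) (fun _ hx => R.D_eq_vorticity hI hk hχ hx) hf hg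

end Integrable

section Enstrophy

variable (R : S.IsRegular a β) (hI : S.Integrability) {w : ℝ → ℝ} {χ f : E3 → ℝ}
include R hI

theorem enstrophy_D (w : ℝ → ℝ) (hχ : χ ∈ S.X) (hf : ContDiff ℝ ∞ f) (h : EqOn χ f S.Ω) :
    S.enstrophy w (S.D χ) = ∫ x in S.Ω, a x * w (vorticity β S.lam S.sig f x) := by
  rw [enstrophy, R.Dinv_D hχ]
  refine R.setIntegral_congr fun x hx => ?_
  have hA : S.A x ≠ 0 := by
    rw [R.A_eq x hx]
    exact (R.weight.pos x hx).ne'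
  simp only [← R.D_div_A hI hf h hx, D, indicator_of_mem hx, ← R.A_eq x hx]
  congr 2
  field_simp

theorem enstrophy_D_add_smul (w : ℝ → ℝ) {ξ g : E3 → ℝ} (hχ : χ ∈ S.X) (hξ : ξ ∈ S.X)
    (hf : ContDiff ℝ ∞ f) (hg : ContDiff ℝ ∞ g) (hχf : EqOn χ f S.Ω) (hξg : EqOn ξ g S.Ω)
    (s : ℝ) : S.enstrophy w (S.D (χ + s • ξ)) = ∫ x in S.Ω,
      a x * w (vorticity β S.lam S.sig f x + s * vorticity β S.lam S.sig g x) := by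
  have hrep : EqOn (χ + s • ξ) (fun y => f y + s * g y) S.Ω := fun y hy => by
    simp [hχf hy, hξg hy]
  rw [R.enstrophy_D hI w (S.X.add_mem hχ (S.X.smul_mem s hξ)) (by fun_prop) hrep]
  refine R.setIntegral_congr fun x hx => ?_
  simp only [← R.D_div_A hI (by fun_prop : ContDiff ℝ ∞ fun y => f y + s * g y) hrep hx,
    R.D_add_smul (R.X_subset hχ) (R.X_subset hξ), Pi.add_apply, Pi.smul_apply, smul_eq_mul,
    add_div, mul_div_assoc, R.D_div_A hI hf hχf hx, R.D_div_A hI hg hξg hx]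

variable (hw : ContDiff ℝ ∞ w)
include hw

theorem hasFunDeriv_enstrophy (hχ : χ ∈ S.X) : S.HasFunDeriv (S.enstrophy w) (S.D χ)
    (S.Ω.indicator fun x => deriv w (S.D χ x / S.A x)) := by
  have ha := R.contDiff_a
  have hβ := R.contDiff_β
  obtain ⟨f, hf, hχf⟩ := R.exists_rep_of_mem hχ
  have hmem : (S.Ω.indicator fun x => deriv w (S.D χ x / S.A x)) ∈ SmoothBar S.Ω :=
    (mem_smoothBar_iff R.isBounded).2 ⟨fun x hx => indicator_of_notMem hx _,
      fun x => deriv w (vorticity β S.lam S.sig f x), by fun_prop, fun x hx => by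
        simp only [indicator_of_mem hx, R.D_div_A hI hf hχf hx]⟩
  refine R.hasFunDeriv_of_hasDerivAt hχ hmem fun ξ hξ => ?_
  obtain ⟨g, hg, hξg⟩ := R.exists_rep_of_mem hξ
  simp only [R.enstrophy_D_add_smul hI w hχ hξ hf hg hχf hξg]
  refine (hasDerivAt_setIntegral (h := fun s x => a x *
    w (vorticity β S.lam S.sig f x + s * vorticity β S.lam S.sig g x))
    (ContDiff.of_le (n := ∞) (by fun_prop) (by simp)) R.isBounded 0).congr_deriv ?_
  refine R.setIntegral_congr fun x hx => ?_
  have hline : HasDerivAt (fun s : ℝ => vorticity β S.lam S.sig f x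
      + s * vorticity β S.lam S.sig g x) (vorticity β S.lam S.sig g x) 0 := by
    simpa using ((hasDerivAt_id (0 : ℝ)).mul_const (vorticity β S.lam S.sig g x)).const_add
      (vorticity β S.lam S.sig f x)
  have hchain :=
    ((differentiableAt_of_contDiff_infty hw _).hasDerivAt.comp 0 hline).const_mul (a x)
  simp only [comp_def, zero_mul, add_zero] at hchain
  simp only [hchain.deriv, indicator_of_mem hx, R.D_div_A hI hf hχf hx,
    R.D_eq_vorticity hI hg hξg hx]
  ring

theorem enstrophy_mem_observables : S.enstrophy w ∈ S.Observables := by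
  have hβ := R.contDiff_β
  refine S.mem_observables (fun η => S.Ω.indicator fun x => deriv w (η x / S.A x))
    (fun χ hχ => R.hasFunDeriv_enstrophy hI hw hχ) fun k p hp _ => ?_
  obtain ⟨-, f, hf, hpf⟩ := (smoothFamilyOn_univ_iff R.isBounded).1 hp
  exact (smoothFamilyOn_univ_iff R.isBounded).2 ⟨fun s x hx => indicator_of_notMem hx _,
    fun s x => deriv w (vorticity β S.lam S.sig (f s) x), by fun_prop, fun s x hx => by
      simp only [indicator_of_mem hx, R.D_div_A hI (by fun_prop) (hpf s) hx]⟩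

theorem isCasimir_enstrophy : IsCasimir S.Phase S.Observables S.bracket' (S.enstrophy w) := by
  refine ⟨R.enstrophy_mem_observables hI hw, ?_⟩
  rintro G hG _ ⟨χ, hχ, rfl⟩
  have hβ := R.contDiff_β
  have hw' : ContDiff ℝ ∞ (deriv w) := (contDiff_infty_iff_deriv.1 hw).2
  obtain ⟨f, hf, hχf⟩ := R.exists_rep_of_mem hχ
  obtain ⟨g, hg, hGg⟩ := R.exists_rep_funDeriv hG hχ
  have hW : EqOn (S.funDeriv (S.enstrophy w) (S.D χ))
      (fun x => deriv w (vorticity β S.lam S.sig f x)) S.Ω := fun x hx => by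
    simp only [R.funDeriv_eq (R.hasFunDeriv_enstrophy hI hw hχ), indicator_of_mem hx,
      R.D_div_A hI hf hχf hx]
  have hprimitive (k : ℝ) :
      HasDerivAt (fun k => k * deriv w k - w k) (k * deriv (deriv w) k) k :=
    (((hasDerivAt_id' k).mul (differentiableAt_of_contDiff_infty hw' k).hasDerivAt).sub
      (differentiableAt_of_contDiff_infty hw k).hasDerivAt).congr_deriv (by ring)
  have hzero := R.weight.setIntegral_mul_fieldBracket hβ (R.curl_eq_zero hI)
    (m := fun x => vorticity β S.lam S.sig f x * deriv w (vorticity β S.lam S.sig f x)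
      - w (vorticity β S.lam S.sig f x)) (by fun_prop) (contDiff_const (c := (1 : ℝ))) hg
  simp only [fieldBracket_const, mul_zero, integral_zero, one_mul, zero_eq_neg] at hzero
  rw [R.bracket'_eq hI hf hχf hW hGg, ← hzero]
  congr 1 with x
  rw [fieldBracket_comp β (by fun_prop) (by fun_prop), fieldBracket_comp β
    (hprimitive _).differentiableAt (by fun_prop), (hprimitive _).deriv]
  ring

end Enstrophy

end Setting.IsRegular

/-! ### The equation of motion -/

@[fun_prop]
theorem contDiff_deriv_apply {Z : Type*} [NormedAddCommGroup Z] [NormedSpace ℝ Z] {h : Z → ℝ → ℝ}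
    {g : Z → ℝ} (hh : ContDiff ℝ ∞ (uncurry h)) (hg : ContDiff ℝ ∞ g) :
    ContDiff ℝ ∞ (fun z => deriv (h z) (g z)) :=
  (ContDiff.fderiv (m := ∞) hh hg (by simp)).clm_apply contDiff_const

theorem exists_contDiff_retraction {I : Set ℝ} (hI : IsOpen I) {t : ℝ} (ht : t ∈ I) :
    ∃ ψ : ℝ → ℝ, ContDiff ℝ ∞ ψ ∧ (∀ s, ψ s ∈ I) ∧ ∀ᶠ s in 𝓝 t, ψ s = s := by
  obtain ⟨ε, hε, hεI⟩ := Metric.isOpen_iff.1 hI t ht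
  let ρ : ContDiffBump t := ⟨ε / 2, ε, half_pos hε, half_lt_self hε⟩
  refine ⟨fun s => t + ρ s * (s - t), ?_, fun s => hεI ?_, ?_⟩
  · exact contDiff_const.add (ρ.contDiff.mul (contDiff_id.sub contDiff_const))
  · rw [Metric.mem_ball, Real.dist_eq, add_sub_cancel_left, abs_mul, abs_of_nonneg ρ.nonneg]
    rcases lt_or_ge (dist s t) ε with hs | hs
    · exact (mul_le_of_le_one_left (abs_nonneg _) ρ.le_one).trans_lt hs
    · simpa [ρ.zero_of_le_dist hs] using hε
  · filter_upwards [ρ.eventuallyEq_one] with s hs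
    simp [hs]

namespace Setting.IsRegular

variable {S : Setting} {a : E3 → ℝ} {β : E3 → E3}

section Equation

variable (R : S.IsRegular a β) {F : Functional} {χ : ℝ → E3 → ℝ}
include R

theorem differentiable_D (hχ : SmoothFamilyOn S.Ω univ χ) {x : E3} (hx : x ∈ S.Ω) :
    Differentiable ℝ (fun s => S.D (χ s) x) := by
  have ha := R.contDiff_a
  have hβ := R.contDiff_β
  obtain ⟨-, f, hf, hχf⟩ := (smoothFamilyOn_univ_iff R.isBounded).1 hχ
  simp only [fun s => R.D_eq (hχf s) hx]
  exact ContDiff.differentiable (n := ∞) (by fun_prop) (by simp)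

theorem exists_rep_deriv_D (hχ : SmoothFamilyOn S.Ω univ χ) (t : ℝ) :
    ∃ h : E3 → ℝ, ContDiff ℝ ∞ h ∧ EqOn (fun x => deriv (fun s => S.D (χ s) x) t) h S.Ω := by
  have ha := R.contDiff_a
  have hβ := R.contDiff_β
  obtain ⟨-, f, hf, hχf⟩ := (smoothFamilyOn_univ_iff R.isBounded).1 hχ
  exact ⟨fun x => deriv (fun s => elliptic a β S.lam S.sig (f s) x) t, by fun_prop,
    fun x hx => by simp only [fun s => R.D_eq (hχf s) hx]⟩

theorem exists_rep_rhs {χ : E3 → ℝ} (hχ : χ ∈ S.X) :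
    ∃ h : E3 → ℝ, ContDiff ℝ ∞ h ∧ EqOn (S.rhs χ) h S.Ω := by
  have ha := R.contDiff_a
  have hβ := R.contDiff_β
  obtain ⟨f, hf, hχf⟩ := R.exists_rep_of_mem hχ
  exact ⟨divergence fun y => (a y * (S.sig * inner ℝ (β y) (curl (drift β f) y) - 1)) •
    drift β f y, by fun_prop, fun x hx => R.rhs_eq hχf hx⟩

variable (hI : S.Integrability)
include hI

theorem bracket'_energy (hF : F ∈ S.Observables) {χ : E3 → ℝ} (hχ : χ ∈ S.X) :
    S.bracket' F S.energy (S.D χ) = ∫ x in S.Ω, S.funDeriv F (S.D χ) x * S.rhs χ x := by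
  have hβ := R.contDiff_β
  obtain ⟨f, hf, hχf⟩ := R.exists_rep_of_mem hχ
  obtain ⟨φ, hφ, hFφ⟩ := R.exists_rep_funDeriv hF hχ
  have hE : EqOn (S.funDeriv S.energy (S.D χ)) f S.Ω := by
    rwa [R.funDeriv_eq (R.hasFunDeriv_energy hχ)]
  rw [R.bracket'_eq hI hf hχf hFφ hE, R.weight.setIntegral_mul_fieldBracket hβ
    (R.curl_eq_zero hI) (by fun_prop) hφ hf, ← integral_neg]
  refine R.setIntegral_congr fun x hx => ?_
  simp only [R.rhs_eq_neg_fieldBracket hI hf hχf hx, hFφ hx, mul_neg]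

variable (hχ : SmoothFamilyOn S.Ω univ χ) (hχX : ∀ t, χ t ∈ S.X)
include hχ hχX

theorem hasDerivAt_bracket'_energy (hF : F ∈ S.Observables) {t : ℝ} (h : S.SolvesAt χ t) :
    HasDerivAt (fun s => F (S.D (χ s))) (S.bracket' F S.energy (S.D (χ t))) t := by
  refine (R.hasDerivAt_comp_D hF hχ hχX t).congr_deriv ?_
  rw [R.bracket'_energy hI hF (hχX t)]
  exact R.setIntegral_congr fun x hx => by simp only [(h x hx).deriv]

theorem solvesAt_of_forall_testFunctions {t : ℝ}
    (h : ∀ φ ∈ TestFunctions S.Ω, HasDerivAt (fun s => S.smeared φ (S.D (χ s)))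
      (S.bracket' (S.smeared φ) S.energy (S.D (χ t))) t) : S.SolvesAt χ t := by
  intro x hx
  obtain ⟨d, hd, hDd⟩ := R.exists_rep_deriv_D hχ t
  obtain ⟨r, hr, hrhs⟩ := R.exists_rep_rhs (hχX t)
  have hweak (φ : E3 → ℝ) (hφ : φ ∈ TestFunctions S.Ω) :
      ∫ y in S.Ω, φ y * d y = ∫ y in S.Ω, φ y * r y := by
    have hF := R.smeared_mem_observables hφ
    have heq := (R.hasDerivAt_comp_D hF hχ hχX t).unique (h φ hφ)
    rw [R.bracket'_energy hI hF (hχX t), R.funDeriv_smeared hφ (hχX t)] at heq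
    rw [← R.setIntegral_congr fun y hy => congrArg (φ y * ·) (hDd hy), heq]
    exact R.setIntegral_congr fun y hy => congrArg (φ y * ·) (hrhs hy)
  have hzero := eqOn_zero_of_forall_setIntegral_testFunctions R.isOpen
    (h := fun y => d y - r y) (by fun_prop) fun φ hφ => by
      have hφ' := hφ.1
      simp only [mul_sub]
      rw [integral_sub (R.integrableOn (by fun_prop)) (R.integrableOn (by fun_prop)),
        hweak φ hφ, sub_self]
  rw [hrhs hx, ← sub_eq_zero.1 (hzero hx), ← hDd hx]
  exact (R.differentiable_D hχ hx t).hasDerivAt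

theorem solvesAt_iff_of_univ (t : ℝ) :
    (S.SolvesAt χ t ↔ ∀ φ ∈ TestFunctions S.Ω, HasDerivAt (fun s => S.smeared φ (S.D (χ s)))
      (S.bracket' (S.smeared φ) S.energy (S.D (χ t))) t) ∧
    (S.SolvesAt χ t ↔ ∀ F ∈ S.Observables, HasDerivAt (fun s => F (S.D (χ s)))
      (S.bracket' F S.energy (S.D (χ t))) t) :=
  ⟨⟨fun h _ hφ => R.hasDerivAt_bracket'_energy hI hχ hχX (R.smeared_mem_observables hφ) h,
      R.solvesAt_of_forall_testFunctions hI hχ hχX⟩,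
    fun h _ hF => R.hasDerivAt_bracket'_energy hI hχ hχX hF h,
    fun h => R.solvesAt_of_forall_testFunctions hI hχ hχX
      fun _ hφ => h _ (R.smeared_mem_observables hφ)⟩

end Equation

/-- Reparametrizing time by a map that is the identity near `t` reduces the claim to a field defined
for all times. -/
theorem solvesAt_iff (R : S.IsRegular a β) (hI : S.Integrability) {I : Set ℝ} {χ : ℝ → E3 → ℝ}
    (hIo : IsOpen I) (hχ : SmoothFamilyOn S.Ω I χ) (hχX : ∀ t ∈ I, χ t ∈ S.X) {t : ℝ}
    (ht : t ∈ I) :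
    (S.SolvesAt χ t ↔ ∀ φ ∈ TestFunctions S.Ω, HasDerivAt (fun s => S.smeared φ (S.D (χ s)))
      (S.bracket' (S.smeared φ) S.energy (S.D (χ t))) t) ∧
    (S.SolvesAt χ t ↔ ∀ F ∈ S.Observables, HasDerivAt (fun s => F (S.D (χ s)))
      (S.bracket' F S.energy (S.D (χ t))) t) := by
  obtain ⟨ψ, hψ, hψI, hψt⟩ := exists_contDiff_retraction hIo ht
  have hχψ : SmoothFamilyOn S.Ω univ (fun s => χ (ψ s)) := by
    obtain ⟨h0, U, f, hU, hΩU, hf, hχf⟩ := hχ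
    exact ⟨fun s _ x hx => h0 _ (hψI s) x hx, U, fun z => f (ψ z.1, z.2), hU, hΩU,
      hf.comp (by fun_prop : ContDiff ℝ ∞ fun z : ℝ × E3 => (ψ z.1, z.2)).contDiffOn
        fun z hz => ⟨hψI _, hz.2⟩, fun s _ x hx => hχf _ (hψI s) x hx⟩
  have hderiv (L : (E3 → ℝ) → ℝ) (d : ℝ) :
      HasDerivAt (fun s => L (χ (ψ s))) d t ↔ HasDerivAt (fun s => L (χ s)) d t :=
    EventuallyEq.hasDerivAt_iff (hψt.mono fun s hs => by simp only [hs])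
  have hglobal := R.solvesAt_iff_of_univ hI hχψ (fun s => hχX _ (hψI s)) t
  simpa only [SolvesAt, hψt.self_of_nhds, fun x => hderiv fun c => S.D c x,
    fun F : Functional => hderiv fun c => F (S.D c)] using hglobal

end Setting.IsRegular

/-! ### Mixed partial derivatives -/

section MixedPartials

variable {E F : Type*} [NormedAddCommGroup E] [NormedSpace ℝ E] [NormedAddCommGroup F]
  [NormedSpace ℝ F]

theorem fderiv_prodMk_left {f : E × F → ℝ} {s : E} {y : F} (hf : DifferentiableAt ℝ f (s, y))
    (v : E) : fderiv ℝ (fun s => f (s, y)) s v = fderiv ℝ f (s, y) (v, 0) :=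
  (DFunLike.congr_fun (hf.hasFDerivAt.comp s (hasFDerivAt_prodMk_left s y)).fderiv v).trans
    (by simp)

theorem fderiv_prodMk_right {f : E × F → ℝ} {s : E} {y : F} (hf : DifferentiableAt ℝ f (s, y))
    (w : F) : fderiv ℝ (fun y => f (s, y)) y w = fderiv ℝ f (s, y) (0, w) :=
  (DFunLike.congr_fun (hf.hasFDerivAt.comp y (hasFDerivAt_prodMk_right s y)).fderiv w).trans
    (by simp)

theorem fderiv_fderiv_uncurry_comm {f : E → F → ℝ} (hf : ContDiff ℝ ∞ (uncurry f)) (s v : E)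
    (y w : F) : fderiv ℝ (fun s => fderiv ℝ (f s) y w) s v
      = fderiv ℝ (fun y => fderiv ℝ (fun s => f s y) s v) y w := by
  have hfst (s : E) (y : F) :
      fderiv ℝ (fun s => f s y) s v = fderiv ℝ (uncurry f) (s, y) (v, 0) :=
    fderiv_prodMk_left (f := uncurry f) (by fun_prop) v
  have hsnd (s : E) (y : F) : fderiv ℝ (f s) y w = fderiv ℝ (uncurry f) (s, y) (0, w) :=
    fderiv_prodMk_right (f := uncurry f) (by fun_prop) w
  simp only [hfst, hsnd]
  rw [fderiv_prodMk_left (f := fun z => fderiv ℝ (uncurry f) z (0, w)) (by fun_prop),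
    fderiv_prodMk_right (f := fun z => fderiv ℝ (uncurry f) z (v, 0)) (by fun_prop),
    fderiv_fderiv_apply_comm hf]

theorem hasDerivAt_pd {f : ℝ → E3 → ℝ} (hf : ContDiff ℝ ∞ (uncurry f)) (t : ℝ) (i : Fin 3)
    (x : E3) : HasDerivAt (fun s => pd i (f s) x) (pd i (fun y => deriv (fun s => f s y) t) x) t :=
  (differentiableAt_of_contDiff_infty (by fun_prop) t).hasDerivAt.congr_deriv
    (fderiv_fderiv_uncurry_comm hf t 1 x (EuclideanSpace.single i 1))

theorem hasDerivAt_fieldBracket (β : E3 → E3) {f g : ℝ → E3 → ℝ}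
    (hf : ContDiff ℝ ∞ (uncurry f)) (hg : ContDiff ℝ ∞ (uncurry g)) (t : ℝ) (x : E3) :
    HasDerivAt (fun s => fieldBracket β (f s) (g s) x)
      (fieldBracket β (fun y => deriv (fun s => f s y) t) (g t) x
        + fieldBracket β (f t) (fun y => deriv (fun s => g s y) t) x) t := by
  have hf' := fun i => hasDerivAt_pd hf t i x
  have hg' := fun i => hasDerivAt_pd hg t i x
  simp only [fieldBracket_expand]
  refine ((((hf' 0).fun_mul (((hg' 2).const_mul (β x 1)).fun_sub ((hg' 1).const_mul (β x 2))))
    |>.fun_add ((hf' 1).fun_mul (((hg' 0).const_mul (β x 2)).fun_sub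
      ((hg' 2).const_mul (β x 0))))).fun_add
    ((hf' 2).fun_mul (((hg' 1).const_mul (β x 0)).fun_sub
      ((hg' 0).const_mul (β x 1))))).congr_deriv ?_
  ring

theorem hasDerivAt_setIntegral_mul_fieldBracket {Ω : Set E3} (hΩ : Bornology.IsBounded Ω)
    {β : E3 → E3} (hβ : ContDiff ℝ ∞ β) {m f g : ℝ → E3 → ℝ} (hm : ContDiff ℝ ∞ (uncurry m))
    (hf : ContDiff ℝ ∞ (uncurry f)) (hg : ContDiff ℝ ∞ (uncurry g)) (t : ℝ) :
    HasDerivAt (fun s => ∫ x in Ω, m s x * fieldBracket β (f s) (g s) x)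
      ((∫ x in Ω, deriv (fun s => m s x) t * fieldBracket β (f t) (g t) x)
        + (∫ x in Ω, m t x * fieldBracket β (fun y => deriv (fun s => f s y) t) (g t) x)
        + ∫ x in Ω, m t x * fieldBracket β (f t) (fun y => deriv (fun s => g s y) t) x) t := by
  have hint {h : E3 → ℝ} (hh : ContDiff ℝ ∞ h) : IntegrableOn h Ω :=
    integrableOn_of_continuous hh.continuous hΩ
  refine (hasDerivAt_setIntegral (h := fun s x => m s x * fieldBracket β (f s) (g s) x)
    (ContDiff.of_le (n := ∞) (by fun_prop) (by simp)) hΩ t).congr_deriv ?_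
  have hm' (x : E3) : HasDerivAt (fun s => m s x) (deriv (fun s => m s x) t) t :=
    (differentiableAt_of_contDiff_infty (by fun_prop) t).hasDerivAt
  simp only [((hm' _).fun_mul (hasDerivAt_fieldBracket β hf hg t _)).deriv, mul_add, ← add_assoc]
  rw [integral_add (hint (by fun_prop)) (hint (by fun_prop)),
    integral_add (hint (by fun_prop)) (hint (by fun_prop))]

end MixedPartials

/-! ### The Jacobi identity -/

/-- The derivative of `χ ↦ F_η(𝒟χ)` in the direction `ξ`; the second variation of `F` along `𝒟ξ`
and `𝒟ζ` is its integral against `𝒟ζ`. -/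
def Setting.sndVar (S : Setting) (F : Functional) (χ ξ : E3 → ℝ) (x : E3) : ℝ :=
  deriv (fun t : ℝ => S.funDeriv F (S.D (χ + t • ξ)) x) 0

/-- The field `𝒟⁻¹ ∇ · (η (B/B²) × ∇F_η)`, which generates the flow of `F` up to sign. Like all
functions on `Ω`, the argument of `𝒟⁻¹` is extended by zero. -/
def Setting.hamField (S : Setting) (F : Functional) (η : E3 → ℝ) : E3 → ℝ :=
  S.Dinv (S.Ω.indicator (divergence fun y => η y • cross (S.b y) (grad (S.funDeriv F η) y)))

/-- The functional derivative of `{F, G}'`: the first term comes from the explicit factor `η` of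
the integrand, the others from the dependence of `F_η` and `G_η` on the state. -/
def Setting.bracketDeriv (S : Setting) (F G : Functional) (η : E3 → ℝ) : E3 → ℝ :=
  S.Ω.indicator (fun x =>
      inner ℝ (grad (S.funDeriv F η) x) (cross (S.b x) (grad (S.funDeriv G η) x)))
    + (S.sndVar G (S.Dinv η) (S.hamField F η) - S.sndVar F (S.Dinv η) (S.hamField G η))

namespace Setting.IsRegular

variable {S : Setting} {a : E3 → ℝ} {β : E3 → E3}

section SecondVariation

variable (R : S.IsRegular a β) {P : Type*} [NormedAddCommGroup P] [NormedSpace ℝ P]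
  {F : Functional} {p r : P → E3 → ℝ} {χ ξ ζ : E3 → ℝ}
include R

theorem smoothFamily_const (hχ : χ ∈ SmoothBar S.Ω) :
    SmoothFamilyOn S.Ω univ (fun _ : P => χ) := by
  obtain ⟨h0, f, hf, hχf⟩ := (mem_smoothBar_iff R.isBounded).1 hχ
  exact (smoothFamilyOn_univ_iff R.isBounded).2 ⟨fun _ => h0, fun _ => f, by fun_prop,
    fun _ => hχf⟩

theorem smoothBar_of_smoothFamily (hp : SmoothFamilyOn S.Ω univ p) (s : P) :
    p s ∈ SmoothBar S.Ω := by
  obtain ⟨h0, f, hf, hpf⟩ := (smoothFamilyOn_univ_iff R.isBounded).1 hp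
  exact (mem_smoothBar_iff R.isBounded).2 ⟨h0 s, f s, by fun_prop, hpf s⟩

theorem smoothFamily_add_smul (hp : SmoothFamilyOn S.Ω univ p)
    (hr : SmoothFamilyOn S.Ω univ r) :
    SmoothFamilyOn S.Ω univ (fun z : P × ℝ => p z.1 + z.2 • r z.1) := by
  simpa only [one_smul] using R.smoothFamily_linear (c := fun _ : P × ℝ => 1)
    (R.smoothFamily_comp hp contDiff_fst) (R.smoothFamily_comp hr contDiff_fst)
    contDiff_const contDiff_snd

theorem smoothFamily_line (hχ : χ ∈ SmoothBar S.Ω) (hξ : ξ ∈ SmoothBar S.Ω) :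
    SmoothFamilyOn S.Ω univ (fun s : ℝ => χ + s • ξ) :=
  R.smoothFamily_comp (R.smoothFamily_add_smul (P := ℝ) (R.smoothFamily_const hχ)
    (R.smoothFamily_const hξ)) (contDiff_id.prodMk contDiff_id)

theorem smoothFamily_sndVar [FiniteDimensional ℝ P] (hF : F ∈ S.Observables)
    (hp : SmoothFamilyOn S.Ω univ p) (hpX : ∀ s, p s ∈ S.X) (hr : SmoothFamilyOn S.Ω univ r)
    (hrX : ∀ s, r s ∈ S.X) : SmoothFamilyOn S.Ω univ (fun s => S.sndVar F (p s) (r s)) := by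
  obtain ⟨h0, φ, hφ, hFφ⟩ := (smoothFamilyOn_univ_iff R.isBounded).1
    (R.smoothFamily_funDeriv hF (R.smoothFamily_add_smul hp hr)
      fun z => S.X.add_mem (hpX _) (S.X.smul_mem _ (hrX _)))
  refine (smoothFamilyOn_univ_iff R.isBounded).2 ⟨fun s x hx => ?_,
    fun s x => deriv (fun t => φ (s, t) x) 0, by fun_prop, fun s x hx => ?_⟩
  · simp only [sndVar, fun t : ℝ => h0 (s, t) x hx, deriv_const]
  · simp only [sndVar, fun t : ℝ => hFφ (s, t) hx]

theorem sndVar_mem_smoothBar (hF : F ∈ S.Observables) (hχ : χ ∈ S.X) (hξ : ξ ∈ S.X) :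
    S.sndVar F χ ξ ∈ SmoothBar S.Ω :=
  R.smoothBar_of_smoothFamily (R.smoothFamily_sndVar (P := ℝ) hF
    (R.smoothFamily_const (R.X_subset hχ)) (fun _ => hχ)
    (R.smoothFamily_const (R.X_subset hξ)) fun _ => hξ) 0

theorem exists_rep_sndVar (hF : F ∈ S.Observables) (hχ : χ ∈ S.X) (hξ : ξ ∈ S.X) :
    ∃ φ : ℝ → E3 → ℝ, ContDiff ℝ ∞ (uncurry φ) ∧
      (∀ s : ℝ, EqOn (S.funDeriv F (S.D (χ + s • ξ))) (φ s) S.Ω) ∧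
      EqOn (S.sndVar F χ ξ) (fun x => deriv (fun s => φ s x) 0) S.Ω := by
  obtain ⟨-, φ, hφ, hFφ⟩ := (smoothFamilyOn_univ_iff R.isBounded).1
    (R.smoothFamily_funDeriv hF (R.smoothFamily_line (R.X_subset hχ) (R.X_subset hξ))
      fun s => S.X.add_mem hχ (S.X.smul_mem s hξ))
  exact ⟨φ, hφ, hFφ, fun x hx => by simp only [sndVar, fun s => hFφ s hx]⟩

theorem deriv_deriv_eq_setIntegral_sndVar (hF : F ∈ S.Observables) (hχ : χ ∈ S.X)
    (hξ : ξ ∈ S.X) (hζ : ζ ∈ S.X) :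
    deriv (fun s : ℝ => deriv (fun t : ℝ => F (S.D (χ + s • ξ + t • ζ))) 0) 0
      = ∫ x in S.Ω, S.sndVar F χ ξ x * S.D ζ x := by
  have ha := R.contDiff_a
  have hβ := R.contDiff_β
  obtain ⟨φ, hφ, hFφ, hφ'⟩ := R.exists_rep_sndVar hF hχ hξ
  obtain ⟨g, hg, hζg⟩ := R.exists_rep_of_mem hζ
  have hfirst (s : ℝ) : deriv (fun t : ℝ => F (S.D (χ + s • ξ + t • ζ))) 0
      = ∫ x in S.Ω, φ s x * elliptic a β S.lam S.sig g x := by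
    rw [(R.hasDerivAt_comp_D_line hF (S.X.add_mem hχ (S.X.smul_mem s hξ)) hζ 0).deriv, zero_smul,
      add_zero, R.setIntegral_mul_D (hFφ s) hζg]
  simp only [hfirst]
  rw [R.setIntegral_mul_D hφ' hζg, (hasDerivAt_setIntegral
    (h := fun s x => φ s x * elliptic a β S.lam S.sig g x)
    (ContDiff.of_le (n := ∞) (by fun_prop) (by simp)) R.isBounded 0).deriv]
  congr 1 with x
  exact deriv_mul_const (differentiableAt_of_contDiff_infty (by fun_prop) 0) _

theorem setIntegral_sndVar_comm (hF : F ∈ S.Observables) (hχ : χ ∈ S.X) (hξ : ξ ∈ S.X)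
    (hζ : ζ ∈ S.X) :
    ∫ x in S.Ω, S.sndVar F χ ξ x * S.D ζ x = ∫ x in S.Ω, S.sndVar F χ ζ x * S.D ξ x := by
  have hfam : SmoothFamilyOn S.Ω univ (fun z : ℝ × ℝ => χ + z.1 • ξ + z.2 • ζ) :=
    R.smoothFamily_add_smul (R.smoothFamily_line (R.X_subset hχ) (R.X_subset hξ))
      (R.smoothFamily_const (R.X_subset hζ))
  have hsmooth := R.contDiff_comp_D hF hfam fun z =>
    S.X.add_mem (S.X.add_mem hχ (S.X.smul_mem _ hξ)) (S.X.smul_mem _ hζ)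
  have hcomm := fderiv_fderiv_uncurry_comm
    (f := fun s t : ℝ => F (S.D (χ + s • ξ + t • ζ))) hsmooth 0 1 0 1
  simp only [fderiv_apply_one_eq_deriv] at hcomm
  rw [← R.deriv_deriv_eq_setIntegral_sndVar hF hχ hξ hζ,
    ← R.deriv_deriv_eq_setIntegral_sndVar hF hχ hζ hξ, hcomm]
  simp only [add_right_comm]

end SecondVariation

section HamiltonianField

variable (R : S.IsRegular a β) (hInv : S.InverseDefined) {F : Functional}
  (hF : F ∈ S.Observables) {χ : E3 → ℝ} (hχ : χ ∈ S.X)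
include R hInv hF

theorem exists_smoothFamily_hamField {P : Type*} [NormedAddCommGroup P] [NormedSpace ℝ P]
    [FiniteDimensional ℝ P] {p : P → E3 → ℝ} (hp : SmoothFamilyOn S.Ω univ p)
    (hpX : ∀ s, p s ∈ S.X) :
    SmoothFamilyOn S.Ω univ (fun s => S.hamField F (S.D (p s))) ∧
      (∀ s, S.hamField F (S.D (p s)) ∈ S.X) ∧ ∀ s, EqOn (S.D (S.hamField F (S.D (p s))))
        (divergence fun y => S.D (p s) y • cross (S.b y) (grad (S.funDeriv F (S.D (p s))) y))
        S.Ω := by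
  have e : P ≃L[ℝ] (Fin (Module.finrank ℝ P) → ℝ) :=
    ContinuousLinearEquiv.ofFinrankEq (by simp)
  obtain ⟨r, hr, hrX, hDr⟩ := hInv _ (fun s => p (e.symm s))
    (fun s => S.funDeriv F (S.D (p (e.symm s)))) (R.smoothFamily_comp hp e.symm.contDiff)
    (fun s => hpX _) (R.smoothFamily_comp (R.smoothFamily_funDeriv hF hp hpX) e.symm.contDiff)
  have hDre (s : P) : EqOn (S.D (r (e s)))
      (divergence fun y => S.D (p s) y • cross (S.b y) (grad (S.funDeriv F (S.D (p s))) y))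
      S.Ω := fun x hx => by rw [hDr _ x hx, e.symm_apply_apply]
  have hham (s : P) : S.hamField F (S.D (p s)) = r (e s) := by
    rw [← R.Dinv_D (hrX (e s)), hamField, ← indicator_congr (hDre s), D, indicator_indicator,
      inter_self]
  simp only [hham]
  exact ⟨R.smoothFamily_comp hr e.contDiff, fun s => hrX _, hDre⟩

include hχ

theorem hamField_mem : S.hamField F (S.D χ) ∈ S.X :=
  (R.exists_smoothFamily_hamField (P := ℝ) hInv hF (R.smoothFamily_const (R.X_subset hχ))
    fun _ => hχ).2.1 0

variable (hI : S.Integrability) {k f : E3 → ℝ} (hk : ContDiff ℝ ∞ k) (hχk : EqOn χ k S.Ω)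
  (hf : ContDiff ℝ ∞ f) (hFf : EqOn (S.funDeriv F (S.D χ)) f S.Ω)
include hI hk hχk hf hFf

theorem D_hamField {x : E3} (hx : x ∈ S.Ω) :
    S.D (S.hamField F (S.D χ)) x = a x * fieldBracket β (vorticity β S.lam S.sig k) f x := by
  have hβ := R.contDiff_β
  rw [(R.exists_smoothFamily_hamField (P := ℝ) hInv hF (R.smoothFamily_const (R.X_subset hχ))
      fun _ => hχ).2.2 0 hx,
    ← divergence_mul_smul_drift R.contDiff_a hβ (R.curl_eq_zero hI x hx) (by fun_prop) hf]
  refine divergence_eq_of_eqOn R.isOpen (fun y hy => ?_) hx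
  simp only [R.D_eq_vorticity hI hk hχk hy, R.b_eq y hy, grad_eq_of_eqOn R.isOpen hFf hy, drift]

theorem setIntegral_mul_D_hamField {u g : E3 → ℝ} (hg : ContDiff ℝ ∞ g) (hug : EqOn u g S.Ω) :
    ∫ x in S.Ω, u x * S.D (S.hamField F (S.D χ)) x
      = -∫ x in S.Ω, a x * vorticity β S.lam S.sig k x * fieldBracket β g f x := by
  have hβ := R.contDiff_β
  rw [R.weight.setIntegral_mul_fieldBracket hβ (R.curl_eq_zero hI) (by fun_prop) hg hf, neg_neg]
  exact R.setIntegral_congr fun x hx => by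
    simp only [hug hx, R.D_hamField hInv hF hχ hI hk hχk hf hFf hx]

end HamiltonianField

section BracketDeriv

variable (R : S.IsRegular a β) (hInv : S.InverseDefined) {F G : Functional}
  (hF : F ∈ S.Observables) (hG : G ∈ S.Observables)
include R

theorem bracketDeriv_D {χ f g : E3 → ℝ} (hχ : χ ∈ S.X)
    (hFf : EqOn (S.funDeriv F (S.D χ)) f S.Ω) (hGg : EqOn (S.funDeriv G (S.D χ)) g S.Ω) {x : E3}
    (hx : x ∈ S.Ω) : S.bracketDeriv F G (S.D χ) x = fieldBracket β f g x
      + (S.sndVar G χ (S.hamField F (S.D χ)) x - S.sndVar F χ (S.hamField G (S.D χ)) x) := by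
  rw [← fieldBracket_eq_of_eqOn β R.isOpen hFf hGg hx, fieldBracket, drift, ← R.b_eq x hx,
    bracketDeriv, R.Dinv_D hχ, Pi.add_apply, indicator_of_mem hx, Pi.sub_apply]

include hInv hF hG

theorem smoothFamily_bracketDeriv {P : Type*} [NormedAddCommGroup P] [NormedSpace ℝ P]
    [FiniteDimensional ℝ P] {p : P → E3 → ℝ} (hp : SmoothFamilyOn S.Ω univ p)
    (hpX : ∀ s, p s ∈ S.X) :
    SmoothFamilyOn S.Ω univ (fun s => S.bracketDeriv F G (S.D (p s))) := by
  obtain ⟨hrF, hrFX, -⟩ := R.exists_smoothFamily_hamField hInv hF hp hpX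
  obtain ⟨hrG, hrGX, -⟩ := R.exists_smoothFamily_hamField hInv hG hp hpX
  obtain ⟨hu0, u, hu, hFu⟩ := (smoothFamilyOn_univ_iff R.isBounded).1
    (R.smoothFamily_sndVar hF hp hpX hrG hrGX)
  obtain ⟨hv0, v, hv, hGv⟩ := (smoothFamilyOn_univ_iff R.isBounded).1
    (R.smoothFamily_sndVar hG hp hpX hrF hrFX)
  obtain ⟨-, φ, hφ, hFφ⟩ := (smoothFamilyOn_univ_iff R.isBounded).1
    (R.smoothFamily_funDeriv hF hp hpX)
  obtain ⟨-, γ, hγ, hGγ⟩ := (smoothFamilyOn_univ_iff R.isBounded).1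
    (R.smoothFamily_funDeriv hG hp hpX)
  have hβ := R.contDiff_β
  refine (smoothFamilyOn_univ_iff R.isBounded).2 ⟨fun s x hx => ?_,
    fun s x => fieldBracket β (φ s) (γ s) x + (v s x - u s x), by fun_prop, fun s x hx => ?_⟩
  · simp only [bracketDeriv, Pi.add_apply, Pi.sub_apply, indicator_of_notMem hx,
      R.Dinv_D (hpX s), hu0 s x hx, hv0 s x hx, sub_zero, add_zero]
  · rw [R.bracketDeriv_D (hpX s) (hFφ s) (hGγ s) hx, hFu s hx, hGv s hx]

theorem bracketDeriv_mem_smoothBar {χ : E3 → ℝ} (hχ : χ ∈ S.X) :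
    S.bracketDeriv F G (S.D χ) ∈ SmoothBar S.Ω :=
  R.smoothBar_of_smoothFamily (R.smoothFamily_bracketDeriv (P := ℝ) hInv hF hG
    (R.smoothFamily_const (R.X_subset hχ)) fun _ => hχ) 0

theorem setIntegral_bracketDeriv_mul_D {χ ξ f g : E3 → ℝ} (hχ : χ ∈ S.X) (hξ : ξ ∈ S.X)
    (hf : ContDiff ℝ ∞ f) (hFf : EqOn (S.funDeriv F (S.D χ)) f S.Ω) (hg : ContDiff ℝ ∞ g)
    (hGg : EqOn (S.funDeriv G (S.D χ)) g S.Ω) :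
    ∫ x in S.Ω, S.bracketDeriv F G (S.D χ) x * S.D ξ x
      = (∫ x in S.Ω, fieldBracket β f g x * S.D ξ x)
        + ((∫ x in S.Ω, S.sndVar G χ ξ x * S.D (S.hamField F (S.D χ)) x)
          - ∫ x in S.Ω, S.sndVar F χ ξ x * S.D (S.hamField G (S.D χ)) x) := by
  have hrF := R.hamField_mem hInv hF hχ
  have hrG := R.hamField_mem hInv hG hχ
  have hintF := R.integrableOn_mul_D (R.sndVar_mem_smoothBar hF hχ hrG) (R.X_subset hξ)
  have hintG := R.integrableOn_mul_D (R.sndVar_mem_smoothBar hG hχ hrF) (R.X_subset hξ)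
  have hint : IntegrableOn (fun x => fieldBracket β f g x * S.D ξ x) S.Ω := by
    obtain ⟨k, hk, hξk⟩ := R.exists_rep_of_mem hξ
    have ha := R.contDiff_a
    have hβ := R.contDiff_β
    refine (R.integrableOn (h := fun x => fieldBracket β f g x * elliptic a β S.lam S.sig k x)
      (by fun_prop)).congr_fun (fun x hx => ?_) R.isOpen.measurableSet
    simp only [R.D_eq hξk hx]
  rw [R.setIntegral_sndVar_comm hG hχ hξ hrF, R.setIntegral_sndVar_comm hF hχ hξ hrG,
    ← integral_sub hintG hintF, ← integral_add hint (by exact hintG.sub hintF)]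
  refine R.setIntegral_congr fun x hx => ?_
  simp only [R.bracketDeriv_D hχ hFf hGg hx]
  ring

end BracketDeriv

section Jacobi

variable (R : S.IsRegular a β) (hI : S.Integrability)
include R hI

theorem hasDerivAt_bracket'_line {F G : Functional} {χ ξ k h : E3 → ℝ} (hχ : χ ∈ SmoothBar S.Ω)
    (hξ : ξ ∈ SmoothBar S.Ω) (hk : ContDiff ℝ ∞ k) (hχk : EqOn χ k S.Ω) (hh : ContDiff ℝ ∞ h)
    (hξh : EqOn ξ h S.Ω) {φ γ : ℝ → E3 → ℝ} (hφ : ContDiff ℝ ∞ (uncurry φ))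
    (hγ : ContDiff ℝ ∞ (uncurry γ))
    (hFφ : ∀ s : ℝ, EqOn (S.funDeriv F (S.D (χ + s • ξ))) (φ s) S.Ω)
    (hGγ : ∀ s : ℝ, EqOn (S.funDeriv G (S.D (χ + s • ξ))) (γ s) S.Ω) :
    HasDerivAt (fun s : ℝ => S.bracket' F G (S.D (χ + s • ξ)))
      ((∫ x in S.Ω, fieldBracket β (φ 0) (γ 0) x * S.D ξ x)
        + (∫ x in S.Ω, a x * vorticity β S.lam S.sig k x
          * fieldBracket β (fun y => deriv (fun s => φ s y) 0) (γ 0) x)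
        + ∫ x in S.Ω, a x * vorticity β S.lam S.sig k x
          * fieldBracket β (φ 0) (fun y => deriv (fun s => γ s y) 0) x) 0 := by
  have ha := R.contDiff_a
  have hβ := R.contDiff_β
  have hbracket (s : ℝ) : S.bracket' F G (S.D (χ + s • ξ)) = ∫ x in S.Ω,
      (a x * vorticity β S.lam S.sig k x + s * (a x * vorticity β S.lam S.sig h x))
        * fieldBracket β (φ s) (γ s) x :=
    R.weightedBracket_eq (K := fun η => η) (fun x hx => by
      simp only [R.D_add_smul hχ hξ, Pi.add_apply, Pi.smul_apply, smul_eq_mul,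
        R.D_eq_vorticity hI hk hχk hx, R.D_eq_vorticity hI hh hξh hx]) (hFφ s) (hGγ s)
  have hderiv := hasDerivAt_setIntegral_mul_fieldBracket R.isBounded hβ (m := fun s x =>
    a x * vorticity β S.lam S.sig k x + s * (a x * vorticity β S.lam S.sig h x))
    (by fun_prop) hφ hγ 0
  simp only [hbracket]
  simp only [deriv_const_add, deriv_mul_const_field, deriv_id'', one_mul, zero_mul,
    add_zero] at hderiv
  convert hderiv using 3
  refine R.setIntegral_congr fun x hx => ?_
  simp only [R.D_eq_vorticity hI hh hξh hx, mul_comm]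

theorem setIntegral_fieldBracket_jacobi {m f g h : E3 → ℝ} (hm : ContDiff ℝ ∞ m)
    (hf : ContDiff ℝ ∞ f) (hg : ContDiff ℝ ∞ g) (hh : ContDiff ℝ ∞ h) :
    (∫ x in S.Ω, m x * fieldBracket β (fieldBracket β f g) h x)
      + (∫ x in S.Ω, m x * fieldBracket β (fieldBracket β g h) f x)
      + ∫ x in S.Ω, m x * fieldBracket β (fieldBracket β h f) g x = 0 := by
  have hβ := R.contDiff_β
  rw [← integral_add (R.integrableOn (by fun_prop)) (R.integrableOn (by fun_prop)),
    ← integral_add (R.integrableOn (by fun_prop)) (R.integrableOn (by fun_prop))]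
  refine setIntegral_eq_zero_of_forall_eq_zero fun x hx => ?_
  rw [← mul_add, ← mul_add, fieldBracket_jacobi hβ hf hg hh (inner_curl_eq_zero R.contDiff_a hβ
    (R.weight.pos x hx).ne' (R.curl_eq_zero hI x hx)), mul_zero]

variable (hInv : S.InverseDefined) {F G H : Functional} (hF : F ∈ S.Observables)
  (hG : G ∈ S.Observables)
include hInv hF hG

/-- Symmetry of the second variations moves the derivatives of `F_η` and `G_η` onto the
Hamiltonian fields of `G` and `F`. -/
theorem hasFunDeriv_bracket' {χ : E3 → ℝ} (hχ : χ ∈ S.X) :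
    S.HasFunDeriv (S.bracket' F G) (S.D χ) (S.bracketDeriv F G (S.D χ)) := by
  refine R.hasFunDeriv_of_hasDerivAt hχ (R.bracketDeriv_mem_smoothBar hInv hF hG hχ)
    fun ξ hξ => ?_
  obtain ⟨φ, hφ, hFφ, hφ'⟩ := R.exists_rep_sndVar hF hχ hξ
  obtain ⟨γ, hγ, hGγ, hγ'⟩ := R.exists_rep_sndVar hG hχ hξ
  obtain ⟨k, hk, hχk⟩ := R.exists_rep_of_mem hχ
  obtain ⟨h, hh, hξh⟩ := R.exists_rep_of_mem hξ
  have hFφ0 : EqOn (S.funDeriv F (S.D χ)) (φ 0) S.Ω := by simpa using hFφ 0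
  have hGγ0 : EqOn (S.funDeriv G (S.D χ)) (γ 0) S.Ω := by simpa using hGγ 0
  refine (R.hasDerivAt_bracket'_line hI (R.X_subset hχ) (R.X_subset hξ) hk hχk hh hξh hφ hγ
    hFφ hGγ).congr_deriv ?_
  rw [R.setIntegral_bracketDeriv_mul_D hInv hF hG hχ hξ (by fun_prop) hFφ0 (by fun_prop) hGγ0,
    R.setIntegral_mul_D_hamField hInv hF hχ hI hk hχk (by fun_prop) hFφ0 (by fun_prop) hγ',
    R.setIntegral_mul_D_hamField hInv hG hχ hI hk hχk (by fun_prop) hGγ0 (by fun_prop) hφ',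
    ← integral_neg]
  simp only [fieldBracket_antisymm β (fun y => deriv (fun s => γ s y) 0), mul_neg, neg_neg]
  ring

theorem bracket'_mem_observables : S.bracket' F G ∈ S.Observables :=
  S.mem_observables (S.bracketDeriv F G) (fun _ hχ => R.hasFunDeriv_bracket' hI hInv hF hG hχ)
    fun _ _ hp hpX => R.smoothFamily_bracketDeriv hInv hF hG hp hpX

theorem bracket'_bracket' (hH : H ∈ S.Observables) {χ k f g h : E3 → ℝ} (hχ : χ ∈ S.X)
    (hk : ContDiff ℝ ∞ k) (hχk : EqOn χ k S.Ω) (hf : ContDiff ℝ ∞ f)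
    (hFf : EqOn (S.funDeriv F (S.D χ)) f S.Ω) (hg : ContDiff ℝ ∞ g)
    (hGg : EqOn (S.funDeriv G (S.D χ)) g S.Ω) (hh : ContDiff ℝ ∞ h)
    (hHh : EqOn (S.funDeriv H (S.D χ)) h S.Ω) :
    S.bracket' F (S.bracket' G H) (S.D χ)
      = -(∫ x in S.Ω, a x * vorticity β S.lam S.sig k x
          * fieldBracket β (fieldBracket β g h) f x)
        + ((∫ x in S.Ω, S.sndVar H χ (S.hamField F (S.D χ)) x * S.D (S.hamField G (S.D χ)) x)
          - ∫ x in S.Ω, S.sndVar G χ (S.hamField F (S.D χ)) x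
            * S.D (S.hamField H (S.D χ)) x) := by
  have hβ := R.contDiff_β
  have hrF := R.hamField_mem hInv hF hχ
  obtain ⟨j, hj, hGHj⟩ := R.exists_rep_funDeriv (R.bracket'_mem_observables hI hInv hG hH) hχ
  calc S.bracket' F (S.bracket' G H) (S.D χ)
      = -S.bracket' (S.bracket' G H) F (S.D χ) :=
        S.weightedBracket_antisymm (fun η => η) F (S.bracket' G H) (S.D χ)
    _ = ∫ x in S.Ω, S.bracketDeriv G H (S.D χ) x * S.D (S.hamField F (S.D χ)) x := by
        rw [R.bracket'_eq hI hk hχk hGHj hFf,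
          ← R.setIntegral_mul_D_hamField hInv hF hχ hI hk hχk hf hFf hj hGHj,
          R.funDeriv_eq (R.hasFunDeriv_bracket' hI hInv hG hH hχ)]
    _ = _ := by
        rw [R.setIntegral_bracketDeriv_mul_D hInv hG hH hχ hrF hg hGg hh hHh,
          R.setIntegral_mul_D_hamField hInv hF hχ hI hk hχk hf hFf (by fun_prop)
            (eqOn_refl (fieldBracket β g h) _)]

end Jacobi

theorem isPoissonBracket (R : S.IsRegular a β) (hI : S.Integrability) (hInv : S.InverseDefined) :
    IsPoissonBracket S.Phase S.Observables S.bracket' where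
  toIsAntisymmetricBracket := R.isAntisymmetricBracket_bracket'
  bracket_mem F hF G hG := R.bracket'_mem_observables hI hInv hF hG
  jacobi := by
    rintro F hF G hG H hH _ ⟨χ, hχ, rfl⟩
    obtain ⟨k, hk, hχk⟩ := R.exists_rep_of_mem hχ
    obtain ⟨f, hf, hFf⟩ := R.exists_rep_funDeriv hF hχ
    obtain ⟨g, hg, hGg⟩ := R.exists_rep_funDeriv hG hχ
    obtain ⟨h, hh, hHh⟩ := R.exists_rep_funDeriv hH hχ
    have hrF := R.hamField_mem hInv hF hχ
    have hrG := R.hamField_mem hInv hG hχ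
    have hrH := R.hamField_mem hInv hH hχ
    have ha := R.contDiff_a
    have hβ := R.contDiff_β
    have hcyclic := R.setIntegral_fieldBracket_jacobi hI
      (m := fun x => a x * vorticity β S.lam S.sig k x) (by fun_prop) hf hg hh
    rw [R.bracket'_bracket' hI hInv hF hG hH hχ hk hχk hf hFf hg hGg hh hHh,
      R.bracket'_bracket' hI hInv hG hH hF hχ hk hχk hg hGg hh hHh hf hFf,
      R.bracket'_bracket' hI hInv hH hF hG hχ hk hχk hh hHh hf hFf hg hGg,
      R.setIntegral_sndVar_comm hF hχ hrG hrH, R.setIntegral_sndVar_comm hG hχ hrF hrH,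
      R.setIntegral_sndVar_comm hH hχ hrF hrG]
    linarith

end Setting.IsRegular

end GHM

end

theorem mainTheorem2 (S : GHM.Setting)
    (hΩ : IsOpen S.Ω) (hΩb : Bornology.IsBounded S.Ω)
    (hlam : 0 < S.lam) (hsig : 0 < S.sig)
    (hA : GHM.SmoothUpTo S.Ω S.A) (hApos : ∀ x ∈ S.Ω, 0 < S.A x)
    (hA0 : ∀ x ∈ frontier S.Ω, S.A x = 0)
    (hB : GHM.SmoothUpTo S.Ω S.B) (hB0 : ∀ x ∈ closure S.Ω, S.B x ≠ 0)
    (hX : (S.X : Set (GHM.E3 → ℝ)) ⊆ GHM.SmoothBar S.Ω)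
    (hXtest : GHM.TestFunctions S.Ω ⊆ (S.X : Set (GHM.E3 → ℝ))) :
    -- `𝒟` is injective on `𝔛`, and functional derivatives are unique
    Set.InjOn S.D (S.X : Set (GHM.E3 → ℝ)) ∧
    (∀ F η g₁ g₂, S.HasFunDeriv F η g₁ → S.HasFunDeriv F η g₂ → g₁ = g₂) ∧
    -- the original bracket is antisymmetric and the mass is one of its Casimir invariants
    GHM.IsAntisymmetricBracket S.Phase S.Observables S.bracket ∧
    (∀ c : ℝ, GHM.IsCasimir S.Phase S.Observables S.bracket (S.mass c)) ∧
    -- the energy is a smooth functional, with functional derivative `χ`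
    S.energy ∈ S.Observables ∧
    (∀ χ ∈ S.X, S.HasFunDeriv S.energy (S.D χ) χ) ∧
    (S.Integrability →
      -- the modified bracket is a Poisson bracket
      GHM.IsAntisymmetricBracket S.Phase S.Observables S.bracket' ∧
      (S.InverseDefined → GHM.IsPoissonBracket S.Phase S.Observables S.bracket') ∧
      -- the equation has the form `η_t = {η, H_Ω}'`
      (∀ (I : Set ℝ) (χ : ℝ → GHM.E3 → ℝ), IsOpen I → GHM.SmoothFamilyOn S.Ω I χ →
        (∀ t ∈ I, χ t ∈ S.X) → ∀ t ∈ I,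
        (S.SolvesAt χ t ↔ ∀ φ ∈ GHM.TestFunctions S.Ω,
          HasDerivAt (fun s => S.smeared φ (S.D (χ s)))
            (S.bracket' (S.smeared φ) S.energy (S.D (χ t))) t) ∧
        (S.SolvesAt χ t ↔ ∀ F ∈ S.Observables,
          HasDerivAt (fun s => F (S.D (χ s))) (S.bracket' F S.energy (S.D (χ t))) t)) ∧
      -- the generalized enstrophy and the mass are Casimir invariants
      (∀ w : ℝ → ℝ, ContDiff ℝ ∞ w →
        GHM.IsCasimir S.Phase S.Observables S.bracket' (S.enstrophy w)) ∧
      (∀ c : ℝ, GHM.IsCasimir S.Phase S.Observables S.bracket' (S.mass c))) := by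
  obtain ⟨a, β, R⟩ := S.exists_isRegular hΩ hΩb hlam hsig hA hApos hA0 hB hB0 hX hXtest
  exact ⟨R.injOn_D, fun _ _ _ _ => R.hasFunDeriv_unique, R.isAntisymmetricBracket_bracket,
    R.isCasimir_mass _, R.energy_mem_observables, fun _ => R.hasFunDeriv_energy, fun hI =>
    ⟨R.isAntisymmetricBracket_bracket', R.isPoissonBracket hI,
      fun _ _ hIo hχ hχX _ ht => R.solvesAt_iff hI hIo hχ hχX ht,
      fun _ hw => R.isCasimir_enstrophy hI hw, R.isCasimir_mass fun η => η⟩⟩
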